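/- **Setting.** Two replicated, non-colluding servers each store three independent, uniformly distributed messages $W_1,W_2,W_3$ of $L=8$ bits. To retrieve $W_\theta$, the user draws private randomness independent of the messages and sends a query $Q_n^{[\theta]}$ to server $n\in\{1,2\}$, which answers with a bit string $A_n^{[\theta]}$ that is a deterministic function of the query and of the three messages; the number $d_n$ of bits downloaded from server $n$ is determined by the query (so mixed strategies are allowed). A scheme is *correct* if $H(W_\theta\mid A_{1:2}^{[\theta]},Q_{1:2}^{[\theta]})=0$ for every $\theta$, *private* if for $n=1,2$ the distribution of $Q_n^{[\theta]}$ does not depend on $\theta$ (equivalently $I(\theta;Q_n^{[\theta]})=0$), and has rate $8/\mathbb E[d_1+d_2]$. *Stochastic time sharing* between two schemes means that in each epoch one of them is applied, chosen at random with fixed probabilities. Updates are requested one after the other without waiting, the scheme being applied with fresh independent randomness in each epoch. The $i$-th bit ever downloaded from server $n$ takes a time $Z_{n,i}$; the $Z_{n,i}$ are positive, mutually independent, independent of the user's randomness, of finite variance, and for each $n$ identically distributed with mean $\mu_n$. All bits pass through one queue, so an epoch lasts the sum of the delays of its bits. Update $j$ is time-stamped when it is requested and is received at time $s_j$. The age is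 $a(t)=t-u(t)$, with $u(t)$ the time stamp of the latest update received by time $t$ ($u(t)=0$ if there is none); with $l(T)$ the number of updates received by time $T$, the peak age of information is $$\mathrm{pAoI}=\limsup_{T\to\infty}\mathbb E\Big[\frac1{l(T)}\sum_{j=1}^{l(T)}a(s_j^-)\Big].$$ Let $\alpha^*(R_{\min})$ be the minimum of $\mathrm{pAoI}$ over all correct and private schemes of rate at least $R_{\min}$. **Theorem.** Assume $\mu_1\le\mu_2$. Whatever the desired index $\theta$, the minimum $\alpha^*(R_{\min})$ exists and is given by * for $R_{\min}\in[\tfrac12,\tfrac47]$: $$\alpha^*(R_{\min})=\min\Big\{16\mu_1+12\mu_2,\ 16\Big[\tfrac52(\mu_2-\mu_1)+\tfrac1{R_{\min}}(2\mu_1-\mu_2)\Big]\Big\};$$ * for $R_{\min}\in[\tfrac13,\tfrac12]$: $$\alpha^*(R_{\min})=\min\Big\{16\mu_1+12\mu_2,\ 24\mu_1+8\mu_2,\ 8\Big[3(\mu_2-\mu_1)+\tfrac1{R_{\min}}(3\mu_1-\mu_2)\Big]\Big\}.$$ In both ranges $\alpha^*(R_{\min})$ is also the optimal value of the linear program of minimizing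 $2(\mu_1d_1+\mu_2d_2)$ over real $d_1,d_2\ge 0$ and $D=d_1+d_2$ subject to $\tfrac74L\le D\le L/R_{\min}$ and $d_n\ge\max\{\tfrac32L-\tfrac12D,\ \tfrac52L-D\}$ for $n=1,2$, where $L=8$. Moreover there are correct and private schemes $S_{\mathrm I},S_{\mathrm{III}},S_{\mathrm{IV}}$, not depending on the delays or on $R_{\min}$, with constant download sizes $(d_1,d_2)=(24,0)$, $(8,6)$, $(12,4)$ respectively, such that the terms of the minima are attained, under the rate constraint $R_{\min}$, as follows: $16\mu_1+12\mu_2$ by $S_{\mathrm{III}}$; for $R_{\min}\in[\tfrac12,\tfrac47]$ the second term by time sharing that uses $S_{\mathrm{IV}}$ with probability $\tfrac4{R_{\min}}-7$ and $S_{\mathrm{III}}$ otherwise; for $R_{\min}\in[\tfrac13,\tfrac12]$ the term $24\mu_1+8\mu_2$ by $S_{\mathrm{IV}}$, and the third term by time sharing that uses $S_{\mathrm I}$ with probability $\tfrac1{R_{\min}}-2$ and $S_{\mathrm{IV}}$ otherwise. The optimal value $\alpha^*$ is non-decreasing in $R_{\min}\in[\tfrac13,\tfrac47]$. -/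

import Mathlib

open MeasureTheory ProbabilityTheory Filter
open scoped ENNReal

/-- The contents of a replicated server: `M` messages of `L` bits each. -/
abbrev Library (M L : ℕ) : Type := Fin M → Fin L → Bool

/-- A retrieval strategy for `N` replicated servers holding `M` messages of `L` bits.
The user draws private randomness (`Seed`, with law `law`) independently of the messages, sends
a query (a bit string) to every server, and every server returns a bit string that is a
deterministic function of its query and of the library. The number of bits downloaded from a
server is fixed by the query. The user decodes from the queries and the answers. Randomised
(mixed) strategies are included, since the query may select between several strategies. -/
structure PIRScheme (N M L : ℕ) where
  /-- private randomness of the user -/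
  Seed : Type
  [seedSpace : MeasurableSpace Seed]
  /-- distribution of the private randomness -/
  law : Measure Seed
  [law_prob : IsProbabilityMeasure law]
  /-- `query n θ f` is the query to server `n` when message `θ` is desired -/
  query : Fin N → Fin M → Seed → List Bool
  query_meas : ∀ n θ q, MeasurableSet {f | query n θ f = q}
  /-- number of bits requested from server `n` by a query -/
  size : Fin N → List Bool → ℕ
  /-- answer of server `n` -/
  answer : Fin N → List Bool → Library M L → List Bool
  answer_length : ∀ n q W, (answer n q W).length = size n q
  /-- decoder: desired index, all queries, all answers ↦ message -/
  decode : Fin M → (Fin N → List Bool) → (Fin N → List Bool) → Fin L → Bool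

attribute [instance] PIRScheme.seedSpace PIRScheme.law_prob

namespace PIRScheme

variable {N M L : ℕ}

/-- Number of bits downloaded from server `n` when message `θ` is desired. -/
def download (S : PIRScheme N M L) (n : Fin N) (θ : Fin M) (f : S.Seed) : ℕ :=
  S.size n (S.query n θ f)

/-- Correctness, `H(W_θ | A_{1:N}, Q_{1:N}) = 0`: almost surely in the user's randomness and for
every content of the library, the queries and answers determine the desired message. -/
def IsCorrect (S : PIRScheme N M L) : Prop :=
  ∀ θ : Fin M, ∀ᵐ f ∂S.law, ∀ W : Library M L,
    S.decode θ (fun n => S.query n θ f) (fun n => S.answer n (S.query n θ f) W) = W θ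

/-- Perfect privacy, `I(θ; Q_n) = 0`: for each single server the distribution of the query
does not depend on the desired index. -/
def IsPrivate (S : PIRScheme N M L) : Prop :=
  ∀ (n : Fin N) (θ θ' : Fin M) (q : List Bool),
    S.law {f | S.query n θ f = q} = S.law {f | S.query n θ' f = q}

/-- The expected total download cost `𝔼[D]`. -/
noncomputable def expectedDownload (S : PIRScheme N M L) (θ : Fin M) : ℝ≥0∞ :=
  ∫⁻ f, ∑ n, (S.download n θ f : ℝ≥0∞) ∂S.law

/-- The retrieval rate `L / 𝔼[D]`. -/
noncomputable def rate (S : PIRScheme N M L) (θ : Fin M) : ℝ≥0∞ :=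
  (L : ℝ≥0∞) / S.expectedDownload θ

/-- The constraints of the timely PIR problem with minimum retrieval rate `Rmin`. -/
def Feasible (S : PIRScheme N M L) (Rmin : ℝ) : Prop :=
  S.IsCorrect ∧ S.IsPrivate ∧ ∀ θ, ENNReal.ofReal Rmin ≤ S.rate θ

/-- A pure strategy: exactly `d n` bits are downloaded from server `n`, whatever the desired
message and the user's randomness. -/
def HasSizes (S : PIRScheme N M L) (d : Fin N → ℕ) : Prop :=
  ∀ n θ f, S.download n θ f = d n

/-- The law on `Bool` giving `true` probability `p`. -/
noncomputable def coin (p : unitInterval) : Measure Bool :=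
  ENNReal.ofReal (p : ℝ) • Measure.dirac true + ENNReal.ofReal (1 - (p : ℝ)) • Measure.dirac false

instance (p : unitInterval) : IsProbabilityMeasure (coin p) := by
  constructor
  have h0 : (0 : ℝ) ≤ p := p.2.1
  have h1 : (0 : ℝ) ≤ 1 - p := by linarith [p.2.2]
  simp [coin, ← ENNReal.ofReal_add h0 h1]

/-- Stochastic time sharing: with probability `p` use `S`, otherwise use `S'`. The choice is
announced to the servers by the first bit of the queries. -/
noncomputable def timeShare (p : unitInterval) (S S' : PIRScheme N M L) : PIRScheme N M L where
  Seed := Bool × S.Seed × S'.Seed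
  law := (coin p).prod (S.law.prod S'.law)
  query n θ f := if f.1 then true :: S.query n θ f.2.1 else false :: S'.query n θ f.2.2
  query_meas n θ q := by
    have e : {f : Bool × S.Seed × S'.Seed |
        (if f.1 then true :: S.query n θ f.2.1 else false :: S'.query n θ f.2.2) = q} =
        ({true} ×ˢ ({f | S.query n θ f = q.tail ∧ q = true :: q.tail} ×ˢ Set.univ)) ∪
        ({false} ×ˢ (Set.univ ×ˢ {f | S'.query n θ f = q.tail ∧ q = false :: q.tail})) := by
      ext ⟨b, f, f'⟩
      cases b <;> rcases q with _ | ⟨_ | _, q⟩ <;> simp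
    rw [e]
    refine MeasurableSet.union ?_ ?_
    · exact (measurableSet_singleton _).prod
        (((S.query_meas n θ q.tail).inter (MeasurableSet.const _)).prod MeasurableSet.univ)
    · exact (measurableSet_singleton _).prod
        (MeasurableSet.univ.prod ((S'.query_meas n θ q.tail).inter (MeasurableSet.const _)))
  size n q := match q with
    | [] => 0
    | true :: q => S.size n q
    | false :: q => S'.size n q
  answer n q W := match q with
    | [] => []
    | true :: q => S.answer n q W
    | false :: q => S'.answer n q W
  answer_length n q W := by
    rcases q with _ | ⟨_ | _, q⟩
    · rfl
    · exact S'.answer_length n q W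
    · exact S.answer_length n q W
  decode θ Q A :=
    if ∀ n, (Q n).head? = some true then S.decode θ (fun n => (Q n).tail) A
    else S'.decode θ (fun n => (Q n).tail) A

end PIRScheme

/-! ### Age of information along a sample path

`d n j` is the number of bits downloaded from server `n` in the epoch with (0-based) number `j`,
and `z n i` is the delay of the bit number `i` (0-based) received from server `n`. -/

section Age

variable {N : ℕ}

/-- Duration of epoch `j`: the bits of all servers pass through a single queue. -/
def epochTime (d : Fin N → ℕ → ℕ) (z : Fin N → ℕ → ℝ) (j : ℕ) : ℝ :=
  ∑ n, ∑ i ∈ Finset.Ico (∑ k ∈ Finset.range j, d n k) (∑ k ∈ Finset.range (j + 1), d n k), z n i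

/-- Time at which the `j`-th status update (`j ≥ 1`) is received; `0` for `j = 0`. -/
def receiveTime (d : Fin N → ℕ → ℕ) (z : Fin N → ℕ → ℝ) (j : ℕ) : ℝ :=
  ∑ k ∈ Finset.range j, epochTime d z k

/-- Time stamp of the `j`-th status update (`j ≥ 1`): it is requested, and stamped, as soon as
the preceding one has been received (zero-wait policy). -/
def timeStamp (d : Fin N → ℕ → ℕ) (z : Fin N → ℕ → ℝ) (j : ℕ) : ℝ :=
  receiveTime d z (j - 1)

/-- Time stamp of the latest update received by time `t` (`0` if there is none). -/
noncomputable def latestStamp (d : Fin N → ℕ → ℕ) (z : Fin N → ℕ → ℝ) (t : ℝ) : ℝ :=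
  sSup {u | ∃ j, 1 ≤ j ∧ receiveTime d z j ≤ t ∧ u = timeStamp d z j}

/-- Age of information at time `t`. -/
noncomputable def age (d : Fin N → ℕ → ℕ) (z : Fin N → ℕ → ℝ) (t : ℝ) : ℝ :=
  t - latestStamp d z t

/-- Number of status updates received by time `t`. -/
noncomputable def numUpdates (d : Fin N → ℕ → ℕ) (z : Fin N → ℕ → ℝ) (t : ℝ) : ℕ :=
  Set.ncard {j : ℕ | 1 ≤ j ∧ receiveTime d z j ≤ t}

/-- Mean of the peaks of the age (left limits at the reception times) up to time `t`. -/
noncomputable def meanPeak (d : Fin N → ℕ → ℕ) (z : Fin N → ℕ → ℝ) (t : ℝ) : ℝ :=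
  (1 / (numUpdates d z t : ℝ)) *
    ∑ j ∈ Finset.Icc 1 (numUpdates d z t), Function.leftLim (age d z) (receiveTime d z j)

end Age

/-- Delay model: the delays `Z n i` are independent, positive, have finite variance, and for each
server `n` they are identically distributed with mean `μ n`. -/
structure IsDelayModel {Ω : Type*} [MeasurableSpace Ω] (P : Measure Ω) {N : ℕ}
    (Z : Fin N → ℕ → Ω → ℝ) (μ : Fin N → ℝ) : Prop where
  meas : ∀ n i, Measurable (Z n i)
  indep : iIndepFun (fun x : Fin N × ℕ => Z x.1 x.2) P
  ident : ∀ n i, IdentDistrib (Z n i) (Z n 0) P P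
  pos : ∀ n i, ∀ᵐ ω ∂P, 0 < Z n i ω
  finite_variance : ∀ n i, MemLp (Z n i) 2 P
  mean : ∀ n, ∫ ω, Z n 0 ω ∂P = μ n

/-- Long-term peak age when the desired message is `θ` and the user applies `S` in every epoch
with fresh randomness, independent over epochs and independent of the delays. -/
noncomputable def peakAoI {Ω : Type*} [MeasurableSpace Ω] (P : Measure Ω) {N M L : ℕ}
    (Z : Fin N → ℕ → Ω → ℝ) (S : PIRScheme N M L) (θ : Fin M) : ℝ≥0∞ :=
  limsup (fun t : ℝ =>
    ∫⁻ x : Ω × (ℕ → S.Seed),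
      ENNReal.ofReal (meanPeak (fun n j => S.download n θ (x.2 j)) (fun n i => Z n i x.1) t)
      ∂(P.prod (Measure.infinitePi fun _ : ℕ => S.law))) atTop

/-- Objective values of the timely PIR problem with the peak-age metric. -/
def peakValues {Ω : Type*} [MeasurableSpace Ω] (P : Measure Ω) {N : ℕ} (M L : ℕ)
    (Z : Fin N → ℕ → Ω → ℝ) (θ : Fin M) (Rmin : ℝ) : Set ℝ≥0∞ :=
  {v | ∃ S : PIRScheme N M L, S.Feasible Rmin ∧ v = peakAoI P Z S θ}

/-- Objective values of the linear program over download sizes to which the problem with two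
servers and three messages of `L` bits is reduced. -/
def lpValues (L : ℝ) (μ : Fin 2 → ℝ) (Rmin : ℝ) : Set ℝ :=
  {v | ∃ (d : Fin 2 → ℝ) (D : ℝ), (∀ n, 0 ≤ d n) ∧ ∑ n, d n = D ∧
    7 / 4 * L ≤ D ∧ D ≤ L / Rmin ∧
    (∀ n, max (3 / 2 * L - 1 / 2 * D) (5 / 2 * L - D) ≤ d n) ∧ v = 2 * ∑ n, μ n * d n}


/-!
In the zero-wait regime the peaks of the age are sums of two consecutive epoch durations, so by
the strong law of large numbers the peak age of a scheme is at least `2 ∑ n, μ n * 𝔼[d n]`, with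
equality when downloads are bounded (a maximal inequality dominates the empirical means). The
problem is thus linear in the mean download sizes. The converse of private information retrieval,
the chain rule for entropy along the messages combined with privacy of the single answers,
confines these sizes to the polygon of the linear program. The vertices of this polygon that
matter are realized by three explicit schemes with shifted queries, and its edges by time sharing
between them.
-/

/-! ### Sample paths -/

section SamplePath

open Finset Function
open scoped Topology

theorem tendsto_atTop_of_tendsto_div {s : ℕ → ℝ} {c : ℝ} (hc : 0 < c)
    (hs : Tendsto (fun l : ℕ => s l / l) atTop (𝓝 c)) : Tendsto s atTop atTop := by
  refine (hs.pos_mul_atTop hc tendsto_natCast_atTop_atTop).congr' ?_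
  filter_upwards [eventually_ne_atTop 0] with l hl
  exact div_mul_cancel₀ _ (Nat.cast_ne_zero.2 hl)

theorem tendsto_sum_range_sum_div {y : ℕ → ℝ} {e : ℕ → ℕ} {m δ : ℝ}
    (hy : Tendsto (fun k : ℕ => (∑ i ∈ range k, y i) / k) atTop (𝓝 m))
    (he : Tendsto (fun l : ℕ => (∑ k ∈ range l, (e k : ℝ)) / l) atTop (𝓝 δ)) :
    Tendsto (fun l : ℕ => (∑ i ∈ range (∑ k ∈ range l, e k), y i) / l) atTop (𝓝 (m * δ)) := by
  set E : ℕ → ℕ := fun l => ∑ k ∈ range l, e k with hE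
  set mean : ℕ → ℝ := fun k => (∑ i ∈ range k, y i) / k with hmean
  have hE_div : Tendsto (fun l : ℕ => (E l : ℝ) / l) atTop (𝓝 δ) := by simpa [hE] using he
  have hfactor (l : ℕ) : (∑ i ∈ range (E l), y i) / l = mean (E l) * ((E l : ℝ) / l) := by
    rcases eq_or_ne (E l) 0 with h | h
    · simp [h]
    · have : (E l : ℝ) ≠ 0 := mod_cast h
      simp only [hmean]
      field_simp
  refine Tendsto.congr (fun l => (hfactor l).symm) ?_
  rcases (ge_of_tendsto' hE_div fun l => by positivity : 0 ≤ δ).eq_or_lt with rfl | hδ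
  -- If `δ = 0` then `E` need not tend to infinity, but the means of `y` are bounded.
  · rw [mul_zero]
    obtain ⟨C, hC⟩ := hy.abs.bddAbove_range
    refine squeeze_zero_norm (a := fun l : ℕ => C * ((E l : ℝ) / l)) (fun l => ?_)
      (by simpa using hE_div.const_mul C)
    rw [norm_mul, Real.norm_eq_abs, Real.norm_of_nonneg (by positivity)]
    exact mul_le_mul_of_nonneg_right (hC ⟨E l, rfl⟩) (by positivity)
  · have hE_top : Tendsto E atTop atTop :=
      tendsto_natCast_atTop_iff.1 (tendsto_atTop_of_tendsto_div hδ hE_div)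
    exact (hy.comp hE_top).mul hE_div

theorem tendsto_add_pred_div {s : ℕ → ℝ} {c : ℝ}
    (hs : Tendsto (fun l : ℕ => s l / l) atTop (𝓝 c)) :
    Tendsto (fun l : ℕ => (s l + s (l - 1)) / l) atTop (𝓝 (2 * c)) := by
  rw [← tendsto_add_atTop_iff_nat 1, two_mul]
  have hpred : Tendsto (fun l : ℕ => s l / l * ((l : ℝ) / (l + 1))) atTop (𝓝 c) := by
    simpa using hs.mul (tendsto_natCast_div_add_atTop 1)
  refine (((tendsto_add_atTop_iff_nat 1).2 hs).add hpred).congr' ?_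
  filter_upwards [eventually_gt_atTop 0] with l hl
  push_cast [add_tsub_cancel_right]
  field_simp

variable {N : ℕ} {d : Fin N → ℕ → ℕ} {z : Fin N → ℕ → ℝ} {t : ℝ} {l : ℕ}

theorem receiveTime_eq_sum (d : Fin N → ℕ → ℕ) (z : Fin N → ℕ → ℝ) (l : ℕ) :
    receiveTime d z l = ∑ n, ∑ i ∈ range (∑ k ∈ range l, d n k), z n i := by
  induction l with
  | zero => simp [receiveTime]
  | succ l ih =>
    rw [receiveTime, sum_range_succ, ← receiveTime, ih, epochTime, ← sum_add_distrib]
    exact sum_congr rfl fun n _ =>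
      sum_range_add_sum_Ico _ (sum_le_sum_of_subset (range_mono l.le_succ))

@[simp]
theorem receiveTime_zero : receiveTime d z 0 = 0 := rfl

theorem epochTime_pos (hz : ∀ n i, 0 < z n i) {j : ℕ} (hd : ∃ n, 0 < d n j) :
    0 < epochTime d z j := by
  obtain ⟨n, hn⟩ := hd
  refine sum_pos' (fun m _ => sum_nonneg fun i _ => (hz m i).le)
    ⟨n, mem_univ n, sum_pos (fun i _ => hz n i) ?_⟩
  rw [nonempty_Ico, sum_range_succ]
  exact Nat.lt_add_of_pos_right hn

theorem receiveTime_strictMono (hz : ∀ n i, 0 < z n i) (hd : ∀ j, ∃ n, 0 < d n j) :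
    StrictMono (receiveTime d z) := by
  refine strictMono_nat_of_lt_succ fun j => ?_
  rw [receiveTime, receiveTime, sum_range_succ]
  exact lt_add_of_pos_right _ (epochTime_pos hz (hd j))

theorem numUpdates_eq (hs : StrictMono (receiveTime d z))
    (ht : t ∈ Set.Ico (receiveTime d z l) (receiveTime d z (l + 1))) : numUpdates d z t = l := by
  have hset : {j : ℕ | 1 ≤ j ∧ receiveTime d z j ≤ t} = ↑(Icc 1 l) := by
    ext j
    simp only [Set.mem_ofPred_eq, coe_Icc, Set.mem_Icc, and_congr_right_iff]
    exact fun _ => ⟨fun h => Nat.lt_succ_iff.1 (hs.lt_iff_lt.1 (h.trans_lt ht.2)),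
      fun h => (hs.monotone h).trans ht.1⟩
  rw [numUpdates, hset, Set.ncard_coe_finset, Nat.card_Icc, Nat.add_sub_cancel]

theorem mem_Ico_numUpdates (hs : StrictMono (receiveTime d z))
    (htop : Tendsto (receiveTime d z) atTop atTop) (ht : 0 ≤ t) :
    t ∈ Set.Ico (receiveTime d z (numUpdates d z t)) (receiveTime d z (numUpdates d z t + 1)) := by
  have hunion := iUnion_Ico_map_succ_eq_Ici (fun l => hs.monotone (Nat.zero_le l))
    (not_bddAbove_of_tendsto_atTop htop)
  obtain ⟨l, hl⟩ := Set.mem_iUnion.1 (hunion.ge (show t ∈ Set.Ici (receiveTime d z 0) from ht))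
  rwa [numUpdates_eq hs hl]

theorem latestStamp_eq (hs : StrictMono (receiveTime d z))
    (ht : t ∈ Set.Ico (receiveTime d z l) (receiveTime d z (l + 1))) :
    latestStamp d z t = receiveTime d z (l - 1) := by
  have hle {j : ℕ} (hj : receiveTime d z j ≤ t) : j ≤ l :=
    Nat.lt_succ_iff.1 (hs.lt_iff_lt.1 (hj.trans_lt ht.2))
  rcases Nat.eq_zero_or_pos l with rfl | hl
  · have hempty : {u | ∃ j, 1 ≤ j ∧ receiveTime d z j ≤ t ∧ u = timeStamp d z j} = ∅ := by
      refine Set.eq_empty_of_forall_notMem ?_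
      rintro u ⟨j, hj, hjt, -⟩
      exact absurd (hj.trans (hle hjt)) (by decide)
    rw [latestStamp, hempty, Real.sSup_empty, Nat.zero_sub, receiveTime_zero]
  · refine IsGreatest.csSup_eq ⟨⟨l, hl, ht.1, rfl⟩, ?_⟩
    rintro u ⟨j, -, hjt, rfl⟩
    exact hs.monotone (Nat.sub_le_sub_right (hle hjt) 1)

theorem leftLim_age_receiveTime_succ (hs : StrictMono (receiveTime d z)) (j : ℕ) :
    leftLim (age d z) (receiveTime d z (j + 1)) =
      receiveTime d z (j + 1) - receiveTime d z (j - 1) := by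
  refine leftLim_eq_of_tendsto ?_
  have hcont : Tendsto (fun t : ℝ => t - receiveTime d z (j - 1))
      (𝓝[<] receiveTime d z (j + 1)) (𝓝 (receiveTime d z (j + 1) - receiveTime d z (j - 1))) :=
    ((continuous_id.sub continuous_const).tendsto _).mono_left nhdsWithin_le_nhds
  refine hcont.congr' ?_
  filter_upwards [Ico_mem_nhdsLT (hs j.lt_succ_self)] with t ht
  rw [age, latestStamp_eq hs ht]

theorem sum_leftLim_age (hs : StrictMono (receiveTime d z)) (l : ℕ) :
    ∑ j ∈ Icc 1 l, leftLim (age d z) (receiveTime d z j) =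
      receiveTime d z l + receiveTime d z (l - 1) := by
  induction l with
  | zero => simp
  | succ l ih =>
    rw [sum_Icc_succ_top (Nat.le_add_left 1 l), ih, leftLim_age_receiveTime_succ hs,
      Nat.add_sub_cancel]
    ring

theorem meanPeak_eq (hs : StrictMono (receiveTime d z)) (t : ℝ) :
    meanPeak d z t = (receiveTime d z (numUpdates d z t) +
      receiveTime d z (numUpdates d z t - 1)) / numUpdates d z t := by
  rw [meanPeak, sum_leftLim_age hs, one_div, inv_mul_eq_div]

theorem meanPeak_le (hs : StrictMono (receiveTime d z)) (t : ℝ) :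
    meanPeak d z t ≤ 2 * (receiveTime d z (numUpdates d z t) / numUpdates d z t) := by
  rw [meanPeak_eq hs, ← mul_div_assoc, two_mul]
  gcongr
  exact hs.monotone (Nat.sub_le _ 1)

theorem receiveTime_div_le {B : ℕ} (hz : ∀ n i, 0 ≤ z n i) (hd : ∀ n j, d n j ≤ B) (l : ℕ) :
    receiveTime d z l / l ≤ B * ∑ n, (∑ i ∈ range (l * B), z n i) / (l * B : ℕ) := by
  rcases B.eq_zero_or_pos with rfl | hB
  · simp [receiveTime_eq_sum, Nat.le_zero.1 (hd _ _)]
  have hcancel (x : ℝ) : x / l = B * (x / (l * B : ℕ)) := by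
    have : (B : ℝ) ≠ 0 := by positivity
    rw [Nat.cast_mul, mul_comm (l : ℝ), ← mul_div_assoc, mul_div_mul_left x _ this]
  rw [receiveTime_eq_sum, hcancel, sum_div]
  gcongr with n
  · exact fun i _ _ => hz n i
  · simpa using sum_le_card_nsmul (range l) (d n) B fun k _ => hd n k

/-- The almost sure behaviour of the downloads `d` and of the delays `z`: every epoch downloads
at least one bit, all delays are positive, and the strong law of large numbers holds with mean
delays `m` and mean downloads `δ`. -/
structure IsRegularPath (d : Fin N → ℕ → ℕ) (z : Fin N → ℕ → ℝ) (m δ : Fin N → ℝ) : Prop where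
  delay_pos : ∀ n i, 0 < z n i
  download_pos : ∀ j, ∃ n, 0 < d n j
  tendsto_delay : ∀ n, Tendsto (fun k : ℕ => (∑ i ∈ range k, z n i) / k) atTop (𝓝 (m n))
  tendsto_download :
    ∀ n, Tendsto (fun l : ℕ => (∑ k ∈ range l, (d n k : ℝ)) / l) atTop (𝓝 (δ n))

namespace IsRegularPath

variable {m δ : Fin N → ℝ}

theorem strictMono (h : IsRegularPath d z m δ) : StrictMono (receiveTime d z) :=
  receiveTime_strictMono h.delay_pos h.download_pos

theorem tendsto_receiveTime_div (h : IsRegularPath d z m δ) :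
    Tendsto (fun l : ℕ => receiveTime d z l / l) atTop (𝓝 (∑ n, m n * δ n)) := by
  simp only [receiveTime_eq_sum, sum_div (univ : Finset (Fin N))]
  exact tendsto_finsetSum _ fun n _ =>
    tendsto_sum_range_sum_div (h.tendsto_delay n) (h.tendsto_download n)

theorem tendsto_receiveTime (h : IsRegularPath d z m δ) (hpos : 0 < ∑ n, m n * δ n) :
    Tendsto (receiveTime d z) atTop atTop :=
  tendsto_atTop_of_tendsto_div hpos h.tendsto_receiveTime_div

theorem tendsto_numUpdates (h : IsRegularPath d z m δ) (hpos : 0 < ∑ n, m n * δ n) :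
    Tendsto (numUpdates d z) atTop atTop := by
  refine tendsto_atTop.2 fun j => ?_
  filter_upwards [eventually_ge_atTop (receiveTime d z j), eventually_ge_atTop 0] with t hj ht
  have hlt := hj.trans_lt (mem_Ico_numUpdates h.strictMono (h.tendsto_receiveTime hpos) ht).2
  exact Nat.lt_succ_iff.1 (h.strictMono.lt_iff_lt.1 hlt)

theorem tendsto_meanPeak (h : IsRegularPath d z m δ) (hpos : 0 < ∑ n, m n * δ n) :
    Tendsto (meanPeak d z) atTop (𝓝 (2 * ∑ n, m n * δ n)) :=
  ((tendsto_add_pred_div h.tendsto_receiveTime_div).comp (h.tendsto_numUpdates hpos)).congr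
    fun t => (meanPeak_eq h.strictMono t).symm

theorem meanPeak_le (h : IsRegularPath d z m δ) {B : ℕ} (hd : ∀ n j, d n j ≤ B) (t : ℝ) :
    ∃ k : ℕ, meanPeak d z t ≤ 2 * (B * ∑ n, (∑ i ∈ range k, z n i) / k) :=
  ⟨numUpdates d z t * B, (_root_.meanPeak_le h.strictMono t).trans <| by
    gcongr
    exact receiveTime_div_le (fun n i => (h.delay_pos n i).le) hd _⟩

end IsRegularPath

end SamplePath

/-! ### A maximal inequality for empirical means -/

section EmpiricalMean

open Finset

theorem exists_le_two_pow_le_two_mul {k : ℕ} (hk : 0 < k) : ∃ j, k ≤ 2 ^ j ∧ 2 ^ j ≤ 2 * k :=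
  ⟨Nat.log 2 k + 1, (Nat.lt_pow_succ_log_self one_lt_two k).le, by
    rw [pow_succ']
    exact Nat.mul_le_mul_left 2 (Nat.pow_log_le_self 2 hk.ne')⟩

theorem mean_le_two_mul_mean {y : ℕ → ℝ} (hy : ∀ i, 0 ≤ y i) {k K : ℕ} (hk : 0 < k) (hkK : k ≤ K)
    (hKk : K ≤ 2 * k) :
    (∑ i ∈ range k, y i) / k ≤ 2 * ((∑ i ∈ range K, y i) / K) := by
  have hsum : ∑ i ∈ range k, y i ≤ ∑ i ∈ range K, y i :=
    sum_le_sum_of_subset_of_nonneg (range_mono hkK) fun i _ _ => hy i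
  have hnonneg : 0 ≤ ∑ i ∈ range K, y i := sum_nonneg fun i _ => hy i
  have hKk' : (K : ℝ) ≤ 2 * k := mod_cast hKk
  have hK : (0 : ℝ) < K := mod_cast hk.trans_le hkK
  calc (∑ i ∈ range k, y i) / k ≤ (∑ i ∈ range K, y i) / (K / 2) :=
        div_le_div₀ hnonneg hsum (half_pos hK) (by linarith)
    _ = 2 * ((∑ i ∈ range K, y i) / K) := by field_simp

theorem iSup_ofReal_mean_le {y : ℕ → ℝ} (hy : ∀ i, 0 ≤ y i) (m : ℝ) :
    ⨆ k : ℕ, ENNReal.ofReal ((∑ i ∈ range k, y i) / k) ≤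
      2 * (ENNReal.ofReal (m + 1) + ∑' j : ℕ,
        ENNReal.ofReal (((∑ i ∈ range (2 ^ j), y i) / (2 ^ j : ℕ) - m) ^ 2)) := by
  refine iSup_le fun k => ?_
  rcases k.eq_zero_or_pos with rfl | hk
  · simp
  obtain ⟨j, hkj, hjk⟩ := exists_le_two_pow_le_two_mul hk
  set A : ℝ := (∑ i ∈ range (2 ^ j), y i) / (2 ^ j : ℕ)
  have hbound : (∑ i ∈ range k, y i) / k ≤ 2 * (m + 1 + (A - m) ^ 2) :=
    (mean_le_two_mul_mean hy hk hkj hjk).trans (by nlinarith [sq_nonneg (A - m - 1)])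
  calc ENNReal.ofReal ((∑ i ∈ range k, y i) / k)
      ≤ ENNReal.ofReal (2 * (m + 1 + (A - m) ^ 2)) := ENNReal.ofReal_le_ofReal hbound
    _ ≤ 2 * (ENNReal.ofReal (m + 1) + ENNReal.ofReal ((A - m) ^ 2)) := by
        rw [ENNReal.ofReal_mul zero_le_two, ENNReal.ofReal_ofNat]
        gcongr
        exact ENNReal.ofReal_add_le
    _ ≤ _ := by
        gcongr
        exact ENNReal.le_tsum (f := fun j : ℕ =>
          ENNReal.ofReal (((∑ i ∈ range (2 ^ j), y i) / (2 ^ j : ℕ) - m) ^ 2)) j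

variable {Ω : Type*} [MeasurableSpace Ω] {P : Measure Ω} {Y : ℕ → Ω → ℝ}

theorem variance_mean_eq (hindep : Pairwise fun i j => IndepFun (Y i) (Y j) P)
    (hident : ∀ i, IdentDistrib (Y i) (Y 0) P P) (hY : MemLp (Y 0) 2 P) (k : ℕ) :
    variance (fun ω => (∑ i ∈ range k, Y i ω) / k) P = variance (Y 0) P / k := by
  have hsum : variance (fun ω => ∑ i ∈ range k, Y i ω) P = k * variance (Y 0) P := by
    rw [← Finset.sum_fn, IndepFun.variance_sum (fun i _ => (hident i).memLp_iff.2 hY)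
      fun i _ j _ hij => hindep hij]
    simp [fun i => (hident i).variance_eq]
  simp_rw [div_eq_mul_inv _ (k : ℝ)]
  rw [variance_mul_const, hsum]
  rcases eq_or_ne (k : ℝ) 0 with hk | hk
  · simp [hk]
  · field_simp

theorem integral_mean_eq (hident : ∀ i, IdentDistrib (Y i) (Y 0) P P) (hY : Integrable (Y 0) P)
    {k : ℕ} (hk : k ≠ 0) : ∫ ω, (∑ i ∈ range k, Y i ω) / k ∂P = ∫ ω, Y 0 ω ∂P := by
  have hk' : (k : ℝ) ≠ 0 := Nat.cast_ne_zero.2 hk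
  rw [integral_div, integral_finsetSum _ fun i _ => (hident i).integrable_iff.2 hY]
  simp only [fun i => (hident i).integral_eq, sum_const, card_range, nsmul_eq_mul]
  field_simp

variable [IsFiniteMeasure P]

theorem lintegral_sq_mean_sub_integral (hindep : Pairwise fun i j => IndepFun (Y i) (Y j) P)
    (hident : ∀ i, IdentDistrib (Y i) (Y 0) P P) (hY : MemLp (Y 0) 2 P) {k : ℕ} (hk : k ≠ 0) :
    ∫⁻ ω, ENNReal.ofReal (((∑ i ∈ range k, Y i ω) / k - ∫ ω, Y 0 ω ∂P) ^ 2) ∂P =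
      ENNReal.ofReal (variance (Y 0) P / k) := by
  have hmean : MemLp (fun ω => (∑ i ∈ range k, Y i ω) / k) 2 P := by
    simp_rw [div_eq_mul_inv _ (k : ℝ)]
    exact (memLp_finsetSum _ fun i _ => (hident i).memLp_iff.2 hY).mul_const _
  rw [← variance_mean_eq hindep hident hY, hmean.ofReal_variance_eq, evariance_eq_lintegral_ofReal,
    integral_mean_eq hident (hY.integrable one_le_two) hk]

/-- By `iSup_ofReal_mean_le` it suffices to control the means along powers of two, whose variances
have a finite sum. -/
theorem lintegral_iSup_mean_ne_top (hindep : Pairwise fun i j => IndepFun (Y i) (Y j) P)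
    (hident : ∀ i, IdentDistrib (Y i) (Y 0) P P) (hY : MemLp (Y 0) 2 P)
    (hnonneg : ∀ᵐ ω ∂P, ∀ i, 0 ≤ Y i ω) :
    ∫⁻ ω, ⨆ k : ℕ, ENNReal.ofReal ((∑ i ∈ range k, Y i ω) / k) ∂P ≠ ∞ := by
  have hmeas (i : ℕ) : AEMeasurable (Y i) P := (hident i).aemeasurable_fst
  have hsum : Summable fun j : ℕ => variance (Y 0) P / (2 ^ j : ℕ) := by
    simpa [div_eq_mul_inv] using summable_geometric_two.mul_left (variance (Y 0) P)
  refine ne_top_of_le_ne_top ?_ (lintegral_mono_ae <|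
    hnonneg.mono fun ω hω => iSup_ofReal_mean_le hω (∫ ω, Y 0 ω ∂P))
  rw [lintegral_const_mul'' _ (by fun_prop), lintegral_add_left (by fun_prop),
    lintegral_tsum fun j => by fun_prop]
  simp_rw [fun j : ℕ => lintegral_sq_mean_sub_integral hindep hident hY (pow_ne_zero j two_ne_zero)]
  rw [← ENNReal.ofReal_tsum_of_nonneg
    (fun j => div_nonneg (variance_nonneg _ _) (Nat.cast_nonneg _)) hsum]
  simp [ENNReal.mul_eq_top]

end EmpiricalMean

/-! ### Random sample paths -/

section RandomPath

open Finset
open scoped Topology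

variable {X : Type*} [MeasurableSpace X] {ν : Measure X}

theorem measurable_apply_of_countable {ι β : Type*} [Countable ι] [MeasurableSpace ι]
    [MeasurableSingletonClass ι] [MeasurableSpace β] {f : ι → X → β} (hf : ∀ i, Measurable (f i))
    {k : X → ι} (hk : Measurable k) : Measurable fun x => f (k x) x :=
  (measurable_from_prod_countable_right (f := fun p : ι × X => f p.1 p.2) hf).comp
    (hk.prodMk measurable_id)

variable {N : ℕ} {d : Fin N → ℕ → X → ℕ} {z : Fin N → ℕ → X → ℝ} {m δ : Fin N → ℝ}

theorem measurable_receiveTime (hd : ∀ n j, Measurable (d n j)) (hz : ∀ n i, Measurable (z n i))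
    (l : ℕ) : Measurable fun x => receiveTime (fun n j => d n j x) (fun n i => z n i x) l := by
  simp only [receiveTime_eq_sum]
  refine measurable_fun_sum _ fun n _ => measurable_apply_of_countable
    (f := fun k x => ∑ i ∈ range k, z n i x) (k := fun x => ∑ j ∈ range l, d n j x) ?_ ?_
  · exact fun k => measurable_fun_sum (range k) fun i _ => hz n i
  · exact measurable_fun_sum (range l) fun j _ => hd n j

theorem measurable_numUpdates (hd : ∀ n j, Measurable (d n j)) (hz : ∀ n i, Measurable (z n i))
    (t : ℝ) : Measurable fun x => numUpdates (fun n j => d n j x) (fun n i => z n i x) t :=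
  measurable_ncard.comp <| measurable_set_iff.2 fun j => measurableSet_setOfPred.1 <|
    (MeasurableSet.const (1 ≤ j)).inter
      (measurableSet_le (measurable_receiveTime hd hz j) measurable_const)

theorem aemeasurable_meanPeak (hd : ∀ n j, Measurable (d n j)) (hz : ∀ n i, Measurable (z n i))
    (hmono : ∀ᵐ x ∂ν, StrictMono (receiveTime (fun n j => d n j x) (fun n i => z n i x))) (t : ℝ) :
    AEMeasurable (fun x => meanPeak (fun n j => d n j x) (fun n i => z n i x) t) ν := by
  have hs := measurable_receiveTime hd hz
  have hpeak : Measurable fun x => (receiveTime (fun n j => d n j x) (fun n i => z n i x)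
      (numUpdates (fun n j => d n j x) (fun n i => z n i x) t) +
      receiveTime (fun n j => d n j x) (fun n i => z n i x)
        (numUpdates (fun n j => d n j x) (fun n i => z n i x) t - 1)) /
      numUpdates (fun n j => d n j x) (fun n i => z n i x) t :=
    measurable_apply_of_countable (f := fun l x =>
      (receiveTime (fun n j => d n j x) (fun n i => z n i x) l +
        receiveTime (fun n j => d n j x) (fun n i => z n i x) (l - 1)) / (l : ℝ))
      (fun l => ((hs l).add (hs (l - 1))).div_const _) (measurable_numUpdates hd hz t)
  exact ⟨_, hpeak, hmono.mono fun x hx => meanPeak_eq hx t⟩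

variable [IsProbabilityMeasure ν]
  (hreg : ∀ᵐ x ∂ν, IsRegularPath (fun n j => d n j x) (fun n i => z n i x) m δ)
  (hpos : 0 < ∑ n, m n * δ n) (hd : ∀ n j, Measurable (d n j)) (hz : ∀ n i, Measurable (z n i))

include hreg hpos hd hz

theorem le_limsup_lintegral_meanPeak :
    ENNReal.ofReal (2 * ∑ n, m n * δ n) ≤ limsup (fun t : ℝ =>
      ∫⁻ x, ENNReal.ofReal (meanPeak (fun n j => d n j x) (fun n i => z n i x) t) ∂ν) atTop := by
  set peak : ℝ → X → ℝ≥0∞ := fun t x =>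
    ENNReal.ofReal (meanPeak (fun n j => d n j x) (fun n i => z n i x) t)
  have hlim : ∀ᵐ x ∂ν, ENNReal.ofReal (2 * ∑ n, m n * δ n) = liminf (fun t => peak t x) atTop :=
    hreg.mono fun x hx => (ENNReal.tendsto_ofReal (hx.tendsto_meanPeak hpos)).liminf_eq.symm
  calc ENNReal.ofReal (2 * ∑ n, m n * δ n)
      = ∫⁻ _, ENNReal.ofReal (2 * ∑ n, m n * δ n) ∂ν := by simp
    _ = ∫⁻ x, liminf (fun t => peak t x) atTop ∂ν := lintegral_congr_ae hlim
    _ ≤ liminf (fun t => ∫⁻ x, peak t x ∂ν) atTop := lintegral_liminf_le' fun t =>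
        (aemeasurable_meanPeak hd hz (hreg.mono fun x hx => hx.strictMono) t).ennreal_ofReal
    _ ≤ limsup (fun t => ∫⁻ x, peak t x ∂ν) atTop := liminf_le_limsup

theorem tendsto_lintegral_meanPeak {B : ℕ} (hB : ∀ n j x, d n j x ≤ B)
    (hsup : ∀ n, ∫⁻ x, ⨆ k : ℕ, ENNReal.ofReal ((∑ i ∈ range k, z n i x) / k) ∂ν ≠ ∞) :
    Tendsto (fun t : ℝ =>
      ∫⁻ x, ENNReal.ofReal (meanPeak (fun n j => d n j x) (fun n i => z n i x) t) ∂ν) atTop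
      (𝓝 (ENNReal.ofReal (2 * ∑ n, m n * δ n))) := by
  have hbound {x : X} (hx : IsRegularPath (fun n j => d n j x) (fun n i => z n i x) m δ) (t : ℝ) :
      ENNReal.ofReal (meanPeak (fun n j => d n j x) (fun n i => z n i x) t) ≤
        2 * (B * ∑ n, ⨆ k : ℕ, ENNReal.ofReal ((∑ i ∈ range k, z n i x) / k)) := by
    obtain ⟨k, hk⟩ := hx.meanPeak_le (fun n j => hB n j x) t
    refine (ENNReal.ofReal_le_ofReal hk).trans ?_
    rw [ENNReal.ofReal_mul zero_le_two, ENNReal.ofReal_mul (Nat.cast_nonneg B),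
      ENNReal.ofReal_sum_of_nonneg fun n _ =>
        div_nonneg (sum_nonneg fun i _ => (hx.delay_pos n i).le) (Nat.cast_nonneg k),
      ENNReal.ofReal_ofNat, ENNReal.ofReal_natCast]
    gcongr with n
    exact le_iSup (fun k : ℕ => ENNReal.ofReal ((∑ i ∈ range k, z n i x) / k)) k
  have hmeas (n : Fin N) :
      Measurable fun x => ⨆ k : ℕ, ENNReal.ofReal ((∑ i ∈ range k, z n i x) / k) := by
    fun_prop
  have hfinite : ∫⁻ x, 2 * (B * ∑ n, ⨆ k : ℕ, ENNReal.ofReal ((∑ i ∈ range k, z n i x) / k)) ∂ν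
      ≠ ∞ := by
    rw [lintegral_const_mul _ (by fun_prop), lintegral_const_mul _ (by fun_prop),
      lintegral_finsetSum _ fun n _ => hmeas n]
    exact ENNReal.mul_ne_top ENNReal.ofNat_ne_top <| ENNReal.mul_ne_top (ENNReal.natCast_ne_top B)
      (ENNReal.sum_ne_top.2 fun n _ => hsup n)
  simpa using tendsto_lintegral_filter_of_dominated_convergence' (μ := ν) (l := atTop)
    (f := fun _ => ENNReal.ofReal (2 * ∑ n, m n * δ n)) _
    (Eventually.of_forall fun t => (aemeasurable_meanPeak hd hz
      (hreg.mono fun x hx => hx.strictMono) t).ennreal_ofReal)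
    (Eventually.of_forall fun t => hreg.mono fun x hx => hbound hx t) hfinite
    (hreg.mono fun x hx => ENNReal.tendsto_ofReal (hx.tendsto_meanPeak hpos))

end RandomPath

/-! ### Delays and downloads -/

section Delays

open Finset
open scoped Topology

theorem integral_pos_of_ae_pos {Ω : Type*} [MeasurableSpace Ω] {P : Measure Ω} [NeZero P]
    {f : Ω → ℝ} (hint : Integrable f P) (hpos : ∀ᵐ ω ∂P, 0 < f ω) : 0 < ∫ ω, f ω ∂P := by
  rw [integral_pos_iff_support_of_nonneg_ae (hpos.mono fun _ h => h.le) hint, pos_iff_ne_zero]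
  intro hsupp
  obtain ⟨ω, hω, hω'⟩ := ((measure_eq_zero_iff_ae_notMem.1 hsupp).and hpos).exists
  exact hω hω'.ne'

theorem ae_tendsto_mean_infinitePi {α : Type*} [MeasurableSpace α] {ρ : Measure α}
    [IsProbabilityMeasure ρ] {h : α → ℝ} (hmeas : Measurable h) (hint : Integrable h ρ) :
    ∀ᵐ g ∂(Measure.infinitePi fun _ : ℕ => ρ),
      Tendsto (fun l : ℕ => (∑ k ∈ range l, h (g k)) / l) atTop (𝓝 (∫ a, h a ∂ρ)) := by
  have hlaw (k : ℕ) : HasLaw (Function.eval k) ρ (Measure.infinitePi fun _ : ℕ => ρ) :=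
    (measurePreserving_eval_infinitePi (fun _ : ℕ => ρ) k).hasLaw
  have hslln := strong_law_ae_real (fun k (g : ℕ → α) => h (g k))
    ((measurePreserving_eval_infinitePi (fun _ : ℕ => ρ) 0).integrable_comp_of_integrable hint)
    (fun i j hij => (iIndepFun_infinitePi fun _ => hmeas).indepFun hij)
    (fun k => ((hlaw k).identDistrib (hlaw 0)).comp hmeas)
  rwa [← (hlaw 0).integral_comp hmeas.aestronglyMeasurable]

namespace IsDelayModel

variable {Ω : Type*} [MeasurableSpace Ω] {P : Measure Ω} {N : ℕ} {Z : Fin N → ℕ → Ω → ℝ}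
  {μ : Fin N → ℝ}

theorem pairwise_indepFun (h : IsDelayModel P Z μ) (n : Fin N) :
    Pairwise fun i j => IndepFun (Z n i) (Z n j) P := fun i j hij =>
  h.indep.indepFun (i := (n, i)) (j := (n, j)) (by simpa using hij)

theorem ae_pos (h : IsDelayModel P Z μ) : ∀ᵐ ω ∂P, ∀ n i, 0 < Z n i ω :=
  ae_all_iff.2 fun n => ae_all_iff.2 fun i => h.pos n i

variable [IsProbabilityMeasure P]

theorem integrable (h : IsDelayModel P Z μ) (n : Fin N) (i : ℕ) : Integrable (Z n i) P :=
  (h.finite_variance n i).integrable one_le_two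

theorem mean_pos (h : IsDelayModel P Z μ) (n : Fin N) : 0 < μ n :=
  h.mean n ▸ integral_pos_of_ae_pos (h.integrable n 0) (h.pos n 0)

theorem ae_tendsto_mean (h : IsDelayModel P Z μ) (n : Fin N) :
    ∀ᵐ ω ∂P, Tendsto (fun k : ℕ => (∑ i ∈ range k, Z n i ω) / k) atTop (𝓝 (μ n)) :=
  h.mean n ▸ strong_law_ae_real (Z n) (h.integrable n 0) (h.pairwise_indepFun n) (h.ident n)

theorem lintegral_iSup_mean_ne_top (h : IsDelayModel P Z μ) (n : Fin N) :
    ∫⁻ ω, ⨆ k : ℕ, ENNReal.ofReal ((∑ i ∈ range k, Z n i ω) / k) ∂P ≠ ∞ :=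
  _root_.lintegral_iSup_mean_ne_top (h.pairwise_indepFun n) (h.ident n) (h.finite_variance n 0)
    (h.ae_pos.mono fun _ hω i => (hω n i).le)

end IsDelayModel

end Delays

/-! ### Peak age of a scheme -/

namespace PIRScheme

open Finset
open scoped Topology

variable {N M L : ℕ} {S : PIRScheme N M L} {θ : Fin M}

theorem measurable_comp_query {α : Type*} [MeasurableSpace α] (S : PIRScheme N M L) (n : Fin N)
    (θ : Fin M) (g : List Bool → α) : Measurable fun f => g (S.query n θ f) := by
  intro A _
  have hfibers : (fun f => g (S.query n θ f)) ⁻¹' A =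
      ⋃ q ∈ {q : List Bool | g q ∈ A}, {f | S.query n θ f = q} := by
    ext f
    simp
  rw [hfibers]
  exact MeasurableSet.biUnion (Set.to_countable _) fun q _ => S.query_meas n θ q

theorem measurable_download (S : PIRScheme N M L) (n : Fin N) (θ : Fin M) :
    Measurable (S.download n θ) :=
  S.measurable_comp_query n θ (S.size n)

/-- The expected number of bits downloaded from server `n`; as a Bochner integral it is only
meaningful when the number of bits is integrable. -/
noncomputable def meanDownload (S : PIRScheme N M L) (n : Fin N) (θ : Fin M) : ℝ :=
  ∫ f, (S.download n θ f : ℝ) ∂S.law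

theorem meanDownload_nonneg (S : PIRScheme N M L) (n : Fin N) (θ : Fin M) :
    0 ≤ S.meanDownload n θ :=
  integral_nonneg fun _ => Nat.cast_nonneg _

/-- The number of downloaded bits is bounded, uniformly in the server, the desired message and the
user's randomness. -/
def HasBoundedDownloads (S : PIRScheme N M L) : Prop :=
  ∃ B, ∀ n θ f, S.download n θ f ≤ B

theorem HasBoundedDownloads.integrable (h : S.HasBoundedDownloads) (n : Fin N) (θ : Fin M) :
    Integrable (fun f => (S.download n θ f : ℝ)) S.law := by
  obtain ⟨B, hB⟩ := h
  refine Integrable.of_bound (C := B)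
    (measurable_from_top.comp (S.measurable_download n θ)).aestronglyMeasurable
    (Eventually.of_forall fun f => ?_)
  rw [Real.norm_natCast]
  exact mod_cast hB n θ f

variable {Ω : Type*} [MeasurableSpace Ω] {P : Measure Ω} [IsProbabilityMeasure P]
  {Z : Fin N → ℕ → Ω → ℝ} {μ : Fin N → ℝ} (hZ : IsDelayModel P Z μ)
  (hint : ∀ n, Integrable (fun f => (S.download n θ f : ℝ)) S.law)
  (hpos : ∀ᵐ f ∂S.law, ∃ n, 0 < S.download n θ f)

include hint hpos in
theorem sum_mul_meanDownload_pos (hμ : ∀ n, 0 < μ n) : 0 < ∑ n, μ n * S.meanDownload n θ := by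
  have hint' (n : Fin N) : Integrable (fun f => μ n * (S.download n θ f : ℝ)) S.law :=
    (hint n).const_mul _
  have hintegral : ∑ n, μ n * S.meanDownload n θ =
      ∫ f, ∑ n, μ n * (S.download n θ f : ℝ) ∂S.law := by
    rw [integral_finsetSum _ fun n _ => hint' n]
    simp_rw [integral_const_mul, meanDownload]
  rw [hintegral]
  refine integral_pos_of_ae_pos (integrable_finsetSum _ fun n _ => hint' n) ?_
  filter_upwards [hpos] with f ⟨n, hn⟩
  exact sum_pos' (fun n _ => mul_nonneg (hμ n).le (Nat.cast_nonneg _))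
    ⟨n, mem_univ n, mul_pos (hμ n) (Nat.cast_pos.2 hn)⟩

include hZ hint hpos

theorem ae_isRegularPath : ∀ᵐ x ∂(P.prod (Measure.infinitePi fun _ : ℕ => S.law)),
    IsRegularPath (fun n j => S.download n θ (x.2 j)) (fun n i => Z n i x.1) μ
      (fun n => S.meanDownload n θ) := by
  have hdelay := hZ.ae_pos.and (ae_all_iff.2 hZ.ae_tendsto_mean)
  have hdownload_pos : ∀ᵐ g ∂(Measure.infinitePi fun _ : ℕ => S.law),
      ∀ j, ∃ n, 0 < S.download n θ (g j) := ae_all_iff.2 fun j =>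
    (measurePreserving_eval_infinitePi (fun _ : ℕ => S.law) j).quasiMeasurePreserving.ae hpos
  have hdownload_lim : ∀ᵐ g ∂(Measure.infinitePi fun _ : ℕ => S.law), ∀ n,
      Tendsto (fun l : ℕ => (∑ k ∈ range l, (S.download n θ (g k) : ℝ)) / l) atTop
        (𝓝 (S.meanDownload n θ)) := ae_all_iff.2 fun n =>
    ae_tendsto_mean_infinitePi (measurable_from_top.comp (S.measurable_download n θ)) (hint n)
  filter_upwards [Measure.quasiMeasurePreserving_fst.ae hdelay,
    Measure.quasiMeasurePreserving_snd.ae (hdownload_pos.and hdownload_lim)] with x hx₁ hx₂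
  exact ⟨hx₁.1, hx₂.1, hx₁.2, hx₂.2⟩

theorem ofReal_le_peakAoI :
    ENNReal.ofReal (2 * ∑ n, μ n * S.meanDownload n θ) ≤ peakAoI P Z S θ :=
  le_limsup_lintegral_meanPeak (ae_isRegularPath hZ hint hpos)
    (sum_mul_meanDownload_pos hint hpos hZ.mean_pos)
    (fun n j => (S.measurable_download n θ).comp ((measurable_pi_apply j).comp measurable_snd))
    (fun n i => (hZ.meas n i).comp measurable_fst)

omit hint in
theorem peakAoI_eq_ofReal (hS : S.HasBoundedDownloads) :
    peakAoI P Z S θ = ENNReal.ofReal (2 * ∑ n, μ n * S.meanDownload n θ) := by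
  obtain ⟨B, hB⟩ := hS
  have hint (n : Fin N) := HasBoundedDownloads.integrable ⟨B, hB⟩ n θ
  refine (tendsto_lintegral_meanPeak (ae_isRegularPath hZ hint hpos)
    (sum_mul_meanDownload_pos hint hpos hZ.mean_pos)
    (fun n j => (S.measurable_download n θ).comp ((measurable_pi_apply j).comp measurable_snd))
    (fun n i => (hZ.meas n i).comp measurable_fst) (fun n j x => hB n θ (x.2 j))
    fun n => ?_).limsup_eq
  have hmeas := hZ.meas n
  have hsup : Measurable fun ω => ⨆ k : ℕ, ENNReal.ofReal ((∑ i ∈ range k, Z n i ω) / k) := by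
    fun_prop
  rw [measurePreserving_fst.lintegral_comp hsup]
  exact hZ.lintegral_iSup_mean_ne_top n

end PIRScheme

/-! ### Information contained in the answers -/

section Information

open Finset
open scoped BigOperators

theorem logb_card_add_expect_logb_le {ι : Type*} [Fintype ι] [Nonempty ι] {r : ι → ℝ}
    (hr : ∀ i, 0 < r i) :
    Real.logb 2 (Fintype.card ι) + 𝔼 i, Real.logb 2 (r i) ≤ Real.logb 2 (∑ i, r i) := by
  have hcard : (Fintype.card ι : ℝ) ≠ 0 := Nat.cast_ne_zero.2 Fintype.card_ne_zero
  have hsum : ∑ i, r i ≠ 0 := (sum_pos (fun i _ => hr i) univ_nonempty).ne'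
  have jensen : 𝔼 i, Real.log (r i) ≤ Real.log (𝔼 i, r i) := by
    have := strictConcaveOn_log_Ioi.concaveOn.le_map_sum (t := univ)
      (w := fun _ : ι => (Fintype.card ι : ℝ)⁻¹) (p := r) (fun _ _ => by positivity)
      (by simp [hcard]) (fun i _ => hr i)
    simpa only [smul_eq_mul, ← mul_sum, inv_mul_eq_div _ (∑ _, _), Fintype.expect_eq_sum_div_card]
      using this
  rw [Fintype.expect_eq_sum_div_card r, Real.log_div hsum hcard] at jensen
  simp only [Real.logb, ← expect_div, ← add_div]
  exact div_le_div_of_nonneg_right (by linarith) (Real.log_nonneg one_le_two)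

theorem expect_expect_update {ι V : Type*} [Fintype ι] [DecidableEq ι] [Fintype V] [Nonempty V]
    (F : (ι → V) → ℝ) (θ : ι) :
    𝔼 W : ι → V, 𝔼 v, F (Function.update W θ v) = 𝔼 W, F W := by
  have hswap : Function.Involutive fun p : (ι → V) × V => (Function.update p.1 θ p.2, p.1 θ) := by
    rintro ⟨W, v⟩
    simp
  calc 𝔼 W : ι → V, 𝔼 v, F (Function.update W θ v)
      = 𝔼 p : (ι → V) × V, F (Function.update p.1 θ p.2) := (expect_product' univ univ _).symm
    _ = 𝔼 p : (ι → V) × V, F p.1 := Fintype.expect_equiv hswap.toPerm _ _ fun _ => rfl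
    _ = 𝔼 W : ι → V, 𝔼 _v : V, F W := expect_product' univ univ fun W _ => F W
    _ = 𝔼 W, F W := by simp only [Fintype.expect_const]

variable {ι V α β : Type*} [Fintype ι] [DecidableEq ι] [Fintype V] [DecidableEq V]
  [DecidableEq α] [DecidableEq β] {A : (ι → V) → α} {s : Finset ι} {W : ι → V}

/-- The values that a function `A` of the messages `W` can still take once the messages in `s` are
known. -/
def possibleValues (A : (ι → V) → α) (s : Finset ι) (W : ι → V) : Finset α :=
  (univ.filter fun W' => ∀ m ∈ s, W' m = W m).image A

/-- The average, over uniform messages `W`, of the number of bits needed to describe `A W` given the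
messages in `s`. Counting possible values (Hartley information) replaces Shannon's conditional
entropy, which it dominates: the converse only uses the inequalities shared by the two notions. -/
noncomputable def condInfo (A : (ι → V) → α) (s : Finset ι) : ℝ :=
  𝔼 W, Real.logb 2 #(possibleValues A s W)

theorem mem_possibleValues {a : α} :
    a ∈ possibleValues A s W ↔ ∃ W', (∀ m ∈ s, W' m = W m) ∧ A W' = a := by
  simp [possibleValues]

theorem card_possibleValues_pos (A : (ι → V) → α) (s : Finset ι) (W : ι → V) :
    (0 : ℝ) < #(possibleValues A s W) :=
  Nat.cast_pos.2 (card_pos.2 ⟨A W, mem_possibleValues.2 ⟨W, fun _ _ => rfl, rfl⟩⟩)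

theorem condInfo_nonneg (A : (ι → V) → α) (s : Finset ι) : 0 ≤ condInfo A s :=
  expect_nonneg fun W _ =>
    Real.logb_nonneg one_lt_two (Nat.one_le_cast.2 (Nat.cast_pos.1 (card_possibleValues_pos A s W)))

theorem condInfo_comp_le (A : (ι → V) → α) (g : α → β) (s : Finset ι) :
    condInfo (g ∘ A) s ≤ condInfo A s := by
  refine expect_le_expect fun W _ =>
    Real.logb_le_logb_of_le one_lt_two (card_possibleValues_pos _ s W) (Nat.cast_le.2 ?_)
  rw [possibleValues, ← image_image]
  exact card_image_le

theorem condInfo_pi_le {κ : Type*} [Fintype κ] (A : κ → (ι → V) → α) (s : Finset ι) :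
    condInfo (fun W n => A n W) s ≤ ∑ n, condInfo (A n) s := by
  classical
  simp only [condInfo]
  rw [← expect_sum_comm]
  refine expect_le_expect fun W _ => ?_
  rw [← Real.logb_prod _ _ fun n _ => (card_possibleValues_pos (A n) s W).ne', ← Nat.cast_prod,
    ← Fintype.card_piFinset]
  refine Real.logb_le_logb_of_le one_lt_two (card_possibleValues_pos _ s W)
    (Nat.cast_le.2 (card_le_card fun a ha => ?_))
  obtain ⟨W', hW', rfl⟩ := mem_possibleValues.1 ha
  exact Fintype.mem_piFinset.2 fun n => mem_possibleValues.2 ⟨W', hW', rfl⟩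

theorem condInfo_le_length [Nonempty V] {A : (ι → V) → List Bool} {d : ℕ}
    (hA : ∀ W, (A W).length = d) (s : Finset ι) : condInfo A s ≤ d := by
  refine expect_le univ_nonempty fun W _ => ?_
  have hsub : possibleValues A s W ⊆ univ.image (List.Vector.toList : List.Vector Bool d → _) := by
    intro a ha
    obtain ⟨W', -, rfl⟩ := mem_possibleValues.1 ha
    exact mem_image.2 ⟨⟨A W', hA W'⟩, mem_univ _, rfl⟩
  have hcard : #(possibleValues A s W) ≤ 2 ^ d :=
    ((card_le_card hsub).trans card_image_le).trans_eq (by simp [card_vector])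
  rw [Real.logb_le_iff_le_rpow one_lt_two (card_possibleValues_pos A s W), Real.rpow_natCast]
  exact mod_cast hcard

theorem possibleValues_eq_biUnion (A : (ι → V) → α) {θ : ι} (hθ : θ ∉ s) (W : ι → V) :
    possibleValues A s W =
      univ.biUnion fun v => possibleValues A (insert θ s) (Function.update W θ v) := by
  have hupdate (v : V) {m : ι} (hm : m ∈ s) : Function.update W θ v m = W m :=
    Function.update_of_ne (ne_of_mem_of_not_mem hm hθ) _ _
  ext a
  simp only [mem_biUnion, mem_univ, true_and, mem_possibleValues, forall_mem_insert,
    Function.update_self]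
  constructor
  · rintro ⟨W', hW', rfl⟩
    exact ⟨W' θ, W', ⟨rfl, fun m hm => (hW' m hm).trans (hupdate _ hm).symm⟩, rfl⟩
  · rintro ⟨v, W', ⟨-, hW'⟩, rfl⟩
    exact ⟨W', fun m hm => (hW' m hm).trans (hupdate v hm), rfl⟩

theorem card_possibleValues_eq_sum {θ : ι} (hθ : θ ∉ s) (hA : ∀ W W', A W = A W' → W θ = W' θ)
    (W : ι → V) : #(possibleValues A s W) =
      ∑ v, #(possibleValues A (insert θ s) (Function.update W θ v)) := by
  rw [possibleValues_eq_biUnion A hθ W, card_biUnion]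
  intro v _ v' _ hne
  refine disjoint_left.2 fun a ha ha' => hne ?_
  simp only [mem_possibleValues, forall_mem_insert, Function.update_self] at ha ha'
  obtain ⟨U, ⟨rfl, -⟩, rfl⟩ := ha
  obtain ⟨U', ⟨rfl, -⟩, hUU'⟩ := ha'
  exact (hA U' U hUU').symm

/-- A chain rule: the possible values of `A` split according to the message that `A` determines, and
the logarithm of their number is bounded below by concavity. -/
theorem logb_card_add_condInfo_insert_le [Nonempty V] {θ : ι} (hθ : θ ∉ s)
    (hA : ∀ W W', A W = A W' → W θ = W' θ) :
    Real.logb 2 (Fintype.card V) + condInfo A (insert θ s) ≤ condInfo A s := by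
  rw [condInfo, ← expect_expect_update _ θ, ← Fintype.expect_const (ι := ι → V)
    (Real.logb 2 (Fintype.card V)), ← expect_add_distrib]
  refine expect_le_expect fun W _ => ?_
  rw [card_possibleValues_eq_sum hθ hA W, Nat.cast_sum]
  exact logb_card_add_expect_logb_le fun v => card_possibleValues_pos _ _ _

end Information

/-! ### Converse -/

namespace PIRScheme

open Finset

variable {N M L : ℕ} {S : PIRScheme N M L}

theorem condInfo_answer_le_size (S : PIRScheme N M L) (n : Fin N) (q : List Bool)
    (s : Finset (Fin M)) : condInfo (S.answer n q) s ≤ S.size n q :=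
  condInfo_le_length (S.answer_length n q) s

theorem add_condInfo_answer_insert_le {θ : Fin M} {f : S.Seed}
    (hf : ∀ W : Library M L,
      S.decode θ (fun n => S.query n θ f) (fun n => S.answer n (S.query n θ f) W) = W θ)
    (n : Fin N) {s : Finset (Fin M)} (hθ : θ ∉ s) :
    L + condInfo (S.answer n (S.query n θ f)) (insert θ s) ≤
      ∑ k, condInfo (S.answer k (S.query k θ f)) s := by
  let answers : Library M L → Fin N → List Bool := fun W k => S.answer k (S.query k θ f) W
  have hanswers (W W' : Library M L) (h : answers W = answers W') : W θ = W' θ := by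
    rw [← hf W, ← hf W']
    exact congrArg _ h
  calc (L : ℝ) + condInfo (S.answer n (S.query n θ f)) (insert θ s)
      ≤ L + condInfo answers (insert θ s) := by
        gcongr
        exact condInfo_comp_le answers (Function.eval n) _
    _ = Real.logb 2 (Fintype.card (Fin L → Bool)) + condInfo answers (insert θ s) := by
        simp [Real.logb_pow]
    _ ≤ condInfo answers s := logb_card_add_condInfo_insert_le hθ hanswers
    _ ≤ ∑ k, condInfo (S.answer k (S.query k θ f)) s := condInfo_pi_le _ s

theorem IsCorrect.ae_download_pos [NeZero N] (hS : S.IsCorrect) (hL : 0 < L) (θ : Fin M) :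
    ∀ᵐ f ∂S.law, ∃ n, 0 < S.download n θ f := by
  filter_upwards [hS θ] with f hf
  have hdownload : (0 : ℝ) < ∑ n, (S.download n θ f : ℝ) :=
    calc (0 : ℝ) < L := Nat.cast_pos.2 hL
      _ ≤ L + condInfo (S.answer 0 (S.query 0 θ f)) (insert θ ∅) :=
        le_add_of_nonneg_right (condInfo_nonneg _ _)
      _ ≤ ∑ n, condInfo (S.answer n (S.query n θ f)) ∅ :=
        add_condInfo_answer_insert_le hf 0 (notMem_empty θ)
      _ ≤ ∑ n, (S.download n θ f : ℝ) := sum_le_sum fun n _ => S.condInfo_answer_le_size n _ _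
  by_contra! hzero
  simp [Nat.le_zero.1 (hzero _)] at hdownload

theorem IsPrivate.integral_comp_query_eq (hS : S.IsPrivate) (n : Fin N) (θ θ' : Fin M)
    (g : List Bool → ℝ) :
    ∫ f, g (S.query n θ f) ∂S.law = ∫ f, g (S.query n θ' f) ∂S.law := by
  let _ : MeasurableSpace (List Bool) := ⊤
  have hquery (θ : Fin M) : Measurable (S.query n θ) := S.measurable_comp_query n θ id
  have hmap : S.law.map (S.query n θ) = S.law.map (S.query n θ') := by
    refine Measure.ext_of_singleton fun q => ?_
    rw [Measure.map_apply (hquery θ) trivial, Measure.map_apply (hquery θ') trivial]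
    exact hS n θ θ' q
  have hg (ν : Measure (List Bool)) : AEStronglyMeasurable g ν :=
    (measurable_from_top (f := g)).aestronglyMeasurable
  rw [← integral_map (hquery θ).aemeasurable (hg _), hmap,
    integral_map (hquery θ').aemeasurable (hg _)]

/-- The average information content of the answer of server `n` given the messages in `s`, when
message `θ` is desired. -/
noncomputable def meanInfo (S : PIRScheme N M L) (n : Fin N) (θ : Fin M) (s : Finset (Fin M)) : ℝ :=
  ∫ f, condInfo (S.answer n (S.query n θ f)) s ∂S.law

theorem meanInfo_nonneg (S : PIRScheme N M L) (n : Fin N) (θ : Fin M) (s : Finset (Fin M)) :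
    0 ≤ S.meanInfo n θ s :=
  integral_nonneg fun _ => condInfo_nonneg _ _

theorem IsPrivate.meanInfo_eq (hS : S.IsPrivate) (n : Fin N) (θ θ' : Fin M)
    (s : Finset (Fin M)) : S.meanInfo n θ s = S.meanInfo n θ' s :=
  hS.integral_comp_query_eq n θ θ' fun q => condInfo (S.answer n q) s

theorem integrable_condInfo_answer {n : Fin N} {θ : Fin M}
    (hint : Integrable (fun f => (S.download n θ f : ℝ)) S.law) (s : Finset (Fin M)) :
    Integrable (fun f => condInfo (S.answer n (S.query n θ f)) s) S.law := by
  refine hint.mono' (S.measurable_comp_query n θ fun q =>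
    condInfo (S.answer n q) s).aestronglyMeasurable (Eventually.of_forall fun f => ?_)
  rw [Real.norm_of_nonneg (condInfo_nonneg _ _)]
  exact S.condInfo_answer_le_size n _ s

theorem meanInfo_le_meanDownload {n : Fin N} {θ : Fin M}
    (hint : Integrable (fun f => (S.download n θ f : ℝ)) S.law) (s : Finset (Fin M)) :
    S.meanInfo n θ s ≤ S.meanDownload n θ :=
  integral_mono (integrable_condInfo_answer hint s) hint fun _ => S.condInfo_answer_le_size n _ s

theorem IsCorrect.add_meanInfo_insert_le (hS : S.IsCorrect) {θ : Fin M}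
    (hint : ∀ n, Integrable (fun f => (S.download n θ f : ℝ)) S.law) (n : Fin N)
    {s : Finset (Fin M)} (hθ : θ ∉ s) :
    L + S.meanInfo n θ (insert θ s) ≤ ∑ k, S.meanInfo k θ s := by
  have hinfo (k : Fin N) (s : Finset (Fin M)) := integrable_condInfo_answer (hint k) s
  calc (L : ℝ) + S.meanInfo n θ (insert θ s)
      = ∫ f, ((L : ℝ) + condInfo (S.answer n (S.query n θ f)) (insert θ s)) ∂S.law := by
        simp [integral_add (integrable_const _) (hinfo n _), meanInfo]
    _ ≤ ∫ f, ∑ k, condInfo (S.answer k (S.query k θ f)) s ∂S.law := by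
        refine integral_mono_ae ((integrable_const _).add (hinfo n _))
          (integrable_finsetSum _ fun k _ => hinfo k s) ?_
        filter_upwards [hS θ] with f hf
        exact add_condInfo_answer_insert_le hf n hθ
    _ = ∑ k, S.meanInfo k θ s := integral_finsetSum _ fun k _ => hinfo k s

/-- The chain rule is applied to the desired messages `0`, `1`, `2` in turn; by privacy the
information content of a single answer is the same in the three cases. -/
theorem meanDownload_bounds {S : PIRScheme 2 3 L} (hc : S.IsCorrect) (hp : S.IsPrivate)
    (hint : ∀ n θ, Integrable (fun f => (S.download n θ f : ℝ)) S.law) (θ : Fin 3) :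
    7 / 4 * (L : ℝ) ≤ ∑ n, S.meanDownload n θ ∧
    ∀ n, max (3 / 2 * (L : ℝ) - 1 / 2 * ∑ n, S.meanDownload n θ)
      (5 / 2 * (L : ℝ) - ∑ n, S.meanDownload n θ) ≤ S.meanDownload n θ := by
  have hchain (n : Fin 2) {θ' : Fin 3} {s : Finset (Fin 3)} (hθ' : θ' ∉ s) :
      L + S.meanInfo n θ (insert θ' s) ≤ ∑ k, S.meanInfo k θ s := by
    simpa only [hp.meanInfo_eq _ θ' θ] using hc.add_meanInfo_insert_le (hint · θ') n hθ'
  have hle (n : Fin 2) (s : Finset (Fin 3)) : S.meanInfo n θ s ≤ S.meanDownload n θ :=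
    meanInfo_le_meanDownload (hint n θ) s
  have hfirst (n : Fin 2) : L + S.meanInfo n θ {0} ≤ S.meanDownload 0 θ + S.meanDownload 1 θ := by
    simpa using (hchain n (notMem_empty 0)).trans (sum_le_sum fun k _ => hle k ∅)
  have hsecond (n : Fin 2) :
      L + S.meanInfo n θ {1, 0} ≤ S.meanInfo 0 θ {0} + S.meanInfo 1 θ {0} := by
    simpa using hchain n (show (1 : Fin 3) ∉ {0} by decide)
  have hthird : (L : ℝ) ≤ S.meanInfo 0 θ {1, 0} + S.meanInfo 1 θ {1, 0} := by
    have := hchain 0 (show (2 : Fin 3) ∉ {1, 0} by decide)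
    rw [Fin.sum_univ_two] at this
    linarith [S.meanInfo_nonneg 0 θ (insert 2 {1, 0})]
  simp only [Fin.sum_univ_two, max_le_iff, Fin.forall_fin_two] at hfirst hsecond ⊢
  have hle₁ (n : Fin 2) := hle n {0}
  have hle₂ (n : Fin 2) := hle n {1, 0}
  refine ⟨?_, ⟨?_, ?_⟩, ?_, ?_⟩ <;> linarith [hle₁ 0, hle₁ 1, hle₂ 0, hle₂ 1]

end PIRScheme

/-! ### Rates and time sharing -/

namespace PIRScheme

variable {N M L : ℕ} {S S' : PIRScheme N M L} {θ : Fin M} {R : ℝ}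

theorem expectedDownload_eq_ofReal
    (hint : ∀ n, Integrable (fun f => (S.download n θ f : ℝ)) S.law) :
    S.expectedDownload θ = ENNReal.ofReal (∑ n, S.meanDownload n θ) := by
  have hmeas (n : Fin N) : Measurable fun f => (S.download n θ f : ℝ≥0∞) :=
    measurable_from_top.comp (S.measurable_download n θ)
  rw [expectedDownload, lintegral_finsetSum _ fun n _ => hmeas n,
    ENNReal.ofReal_sum_of_nonneg fun n _ => S.meanDownload_nonneg n θ]
  refine Finset.sum_congr rfl fun n _ => ?_
  rw [meanDownload, ofReal_integral_eq_lintegral_ofReal (hint n)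
    (Eventually.of_forall fun _ => Nat.cast_nonneg _)]
  simp only [ENNReal.ofReal_natCast]

theorem ofReal_le_rate_iff (hint : ∀ n, Integrable (fun f => (S.download n θ f : ℝ)) S.law)
    (hR : 0 < R) (hL : 0 < L) :
    ENNReal.ofReal R ≤ S.rate θ ↔ ∑ n, S.meanDownload n θ ≤ L / R := by
  rw [rate, expectedDownload_eq_ofReal hint, ENNReal.le_div_iff_mul_le
    (Or.inr (Nat.cast_ne_zero.2 hL.ne')) (Or.inl ENNReal.ofReal_ne_top),
    ← ENNReal.ofReal_mul hR.le, ← ENNReal.ofReal_natCast,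
    ENNReal.ofReal_le_ofReal_iff (Nat.cast_nonneg L), le_div_iff₀' hR]

theorem Feasible.mono {R' : ℝ} (hS : S.Feasible R') (h : R ≤ R') : S.Feasible R :=
  ⟨hS.1, hS.2.1, fun θ => (ENNReal.ofReal_le_ofReal h).trans (hS.2.2 θ)⟩

theorem Feasible.integrable (hS : S.Feasible R) (hR : 0 < R) (n : Fin N) (θ : Fin M) :
    Integrable (fun f => (S.download n θ f : ℝ)) S.law := by
  have hfinite : S.expectedDownload θ ≠ ∞ := by
    intro htop
    have hrate := hS.2.2 θ
    rw [rate, htop, ENNReal.div_top, nonpos_iff_eq_zero, ENNReal.ofReal_eq_zero] at hrate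
    exact hrate.not_gt hR
  refine ⟨(measurable_from_top.comp (S.measurable_download n θ)).aestronglyMeasurable,
    lt_of_le_of_lt (lintegral_mono fun f => ?_) hfinite.lt_top⟩
  rw [Real.enorm_of_nonneg (Nat.cast_nonneg _), ENNReal.ofReal_natCast]
  exact Finset.single_le_sum (f := fun n => (S.download n θ f : ℝ≥0∞)) (fun _ _ => zero_le)
    (Finset.mem_univ n)

theorem HasSizes.meanDownload_eq {d : Fin N → ℕ} (hS : S.HasSizes d) (n : Fin N) (θ : Fin M) :
    S.meanDownload n θ = d n := by
  simp [meanDownload, hS n θ]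

theorem HasSizes.hasBoundedDownloads {d : Fin N → ℕ} (hS : S.HasSizes d) :
    S.HasBoundedDownloads :=
  ⟨∑ n, d n, fun n θ f =>
    (hS n θ f).trans_le (Finset.single_le_sum (fun _ _ => Nat.zero_le _) (Finset.mem_univ n))⟩

theorem integral_coin (p : unitInterval) (g : Bool → ℝ) :
    ∫ b, g b ∂(coin p) = p * g true + (1 - p) * g false := by
  have hdirac (b : Bool) (c : ℝ) :
      Integrable g (ENNReal.ofReal c • Measure.dirac b) :=
    (integrable_dirac (by simp)).smul_measure ENNReal.ofReal_ne_top
  rw [coin, integral_add_measure (hdirac _ _) (hdirac _ _), integral_smul_measure,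
    integral_smul_measure, integral_dirac, integral_dirac, ENNReal.toReal_ofReal p.2.1,
    ENNReal.toReal_ofReal (sub_nonneg.2 p.2.2), smul_eq_mul, smul_eq_mul]

variable (p : unitInterval)

theorem timeShare_download (n : Fin N) (θ : Fin M) (f : (timeShare p S S').Seed) :
    (timeShare p S S').download n θ f =
      if f.1 then S.download n θ f.2.1 else S'.download n θ f.2.2 := by
  obtain ⟨b, f, f'⟩ := f
  cases b <;> rfl

theorem HasBoundedDownloads.timeShare (hS : S.HasBoundedDownloads)
    (hS' : S'.HasBoundedDownloads) : (timeShare p S S').HasBoundedDownloads := by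
  obtain ⟨B, hB⟩ := hS
  obtain ⟨B', hB'⟩ := hS'
  refine ⟨max B B', fun n θ f => ?_⟩
  rw [timeShare_download]
  split_ifs
  · exact (hB n θ _).trans (le_max_left _ _)
  · exact (hB' n θ _).trans (le_max_right _ _)

theorem meanDownload_timeShare (hS : S.HasBoundedDownloads) (hS' : S'.HasBoundedDownloads)
    (n : Fin N) (θ : Fin M) : (timeShare p S S').meanDownload n θ =
      p * S.meanDownload n θ + (1 - p) * S'.meanDownload n θ := by
  have hint : Integrable (fun f => ((timeShare p S S').download n θ f : ℝ))
      ((coin p).prod (S.law.prod S'.law)) := (hS.timeShare p hS').integrable n θ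
  calc (timeShare p S S').meanDownload n θ
      = ∫ b, ∫ f, ((timeShare p S S').download n θ (b, f) : ℝ) ∂(S.law.prod S'.law) ∂(coin p) :=
        integral_prod _ hint
    _ = p * ∫ f, (S.download n θ f.1 : ℝ) ∂(S.law.prod S'.law) +
          (1 - p) * ∫ f, (S'.download n θ f.2 : ℝ) ∂(S.law.prod S'.law) := integral_coin p _
    _ = p * S.meanDownload n θ + (1 - p) * S'.meanDownload n θ := by
        rw [integral_fun_fst fun f => (S.download n θ f : ℝ),
          integral_fun_snd fun f => (S'.download n θ f : ℝ)]
        simp [meanDownload]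

theorem IsCorrect.timeShare [NeZero N] (hS : S.IsCorrect) (hS' : S'.IsCorrect) :
    (timeShare p S S').IsCorrect := by
  intro θ
  have hfst : ∀ᵐ f ∂(coin p).prod (S.law.prod S'.law), ∀ W : Library M L,
      S.decode θ (fun n => S.query n θ f.2.1) (fun n => S.answer n (S.query n θ f.2.1) W) = W θ :=
    Measure.quasiMeasurePreserving_snd.ae (Measure.quasiMeasurePreserving_fst.ae (hS θ))
  have hsnd : ∀ᵐ f ∂(coin p).prod (S.law.prod S'.law), ∀ W : Library M L,
      S'.decode θ (fun n => S'.query n θ f.2.2) (fun n => S'.answer n (S'.query n θ f.2.2) W) =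
        W θ :=
    Measure.quasiMeasurePreserving_snd.ae (Measure.quasiMeasurePreserving_snd.ae (hS' θ))
  change ∀ᵐ f ∂(coin p).prod (S.law.prod S'.law), _
  filter_upwards [hfst, hsnd]
  rintro ⟨b, f, f'⟩ hf hf' W
  cases b
  · simpa [PIRScheme.timeShare] using hf' W
  · simpa [PIRScheme.timeShare] using hf W

theorem timeShare_law_query (n : Fin N) (θ : Fin M) (q : List Bool) :
    (timeShare p S S').law {f | (timeShare p S S').query n θ f = q} =
      match q with
      | [] => 0
      | true :: q => coin p {true} * S.law {f | S.query n θ f = q}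
      | false :: q => coin p {false} * S'.law {f | S'.query n θ f = q} := by
  have hfiber : {f : Bool × S.Seed × S'.Seed | (timeShare p S S').query n θ f = q} =
      match q with
      | [] => ∅
      | true :: q => {true} ×ˢ ({f | S.query n θ f = q} ×ˢ Set.univ)
      | false :: q => {false} ×ˢ (Set.univ ×ˢ {f | S'.query n θ f = q}) := by
    ext ⟨b, f, f'⟩
    cases b <;> rcases q with _ | ⟨_ | _, q⟩ <;> simp [timeShare]
  refine (congrArg ((coin p).prod (S.law.prod S'.law)) hfiber).trans ?_
  rcases q with _ | ⟨_ | _, q⟩ <;> simp [Measure.prod_prod]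

theorem IsPrivate.timeShare (hS : S.IsPrivate) (hS' : S'.IsPrivate) :
    (timeShare p S S').IsPrivate := by
  intro n θ θ' q
  rw [timeShare_law_query, timeShare_law_query]
  rcases q with _ | ⟨_ | _, q⟩
  · rfl
  · simp only [hS' n θ θ' q]
  · simp only [hS n θ θ' q]

end PIRScheme

/-! ### Schemes with shifted queries -/

section Block

variable {B M k d : ℕ}

/-- Block `b` of a library whose messages consist of `B` blocks of `k` bits. -/
def libraryBlock (W : Library M (B * k)) (b : Fin B) : Library M k := fun m i =>
  W m (finProdFinEquiv (b, i))

/-- The concatenation of the `d`-bit strings obtained by applying `A` to each of the `B` blocks of a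
library. -/
def blockAnswer (A : Library M k → Fin d → Bool) (W : Library M (B * k)) : List Bool :=
  List.ofFn fun j : Fin (B * d) => A (libraryBlock W j.divNat) j.modNat

theorem length_blockAnswer (A : Library M k → Fin d → Bool) (W : Library M (B * k)) :
    (blockAnswer A W).length = B * d :=
  List.length_ofFn

theorem blockAnswer_injective {A : Library M k → Fin d → Bool} {W W' : Library M (B * k)}
    (h : blockAnswer A W = blockAnswer A W') (b : Fin B) :
    A (libraryBlock W b) = A (libraryBlock W' b) := by
  funext i
  have hbit := congrFun (List.ofFn_injective h) (finProdFinEquiv (b, i))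
  have hsymm := finProdFinEquiv.symm_apply_apply (b, i)
  rw [finProdFinEquiv_symm_apply, Prod.mk.injEq] at hsymm
  rwa [hsymm.1, hsymm.2] at hbit

theorem eq_of_libraryBlock_eq {W W' : Library M (B * k)} {m : Fin M}
    (h : ∀ b, libraryBlock W b m = libraryBlock W' b m) : W m = W' m := by
  funext j
  obtain ⟨⟨b, i⟩, rfl⟩ := finProdFinEquiv.surjective j
  exact congrFun (h b) i

end Block

section Shift

variable {G : Type} [AddGroup G] [Fintype G] [Encodable G]

/-- A bit string naming the element `x` of a countable type. -/
def toBits {α : Type*} [Encodable α] (x : α) : List Bool :=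
  List.replicate (Encodable.encode x) true

/-- The element named by a bit string; `0` for strings that name none. -/
def ofBits (α : Type*) [Encodable α] [Zero α] (q : List Bool) : α :=
  (Encodable.decode q.length).getD 0

theorem ofBits_toBits {α : Type*} [Encodable α] [Zero α] (x : α) :
    ofBits α (toBits x) = x := by
  simp [ofBits, toBits]

/-- The user draws a uniform element `x` of a finite group and sends `x + c n θ` to server `n`,
which applies `ans n (x + c n θ)` to each of the `B` blocks of the library. -/
noncomputable def shiftScheme {N M k : ℕ} (B : ℕ) (c : Fin N → Fin M → G) {d : Fin N → ℕ}
    (ans : ∀ n, G → Library M k → Fin (d n) → Bool) : PIRScheme N M (B * k) where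
  Seed := G
  seedSpace := ⊤
  law := @PMF.toMeasure G ⊤ (PMF.uniformOfFintype G)
  law_prob := @PMF.toMeasure.isProbabilityMeasure G ⊤ _
  query n θ x := toBits (x + c n θ)
  query_meas _ _ _ := trivial
  size n _ := B * d n
  answer n q W := blockAnswer (ans n (ofBits G q)) W
  answer_length _ _ W := length_blockAnswer _ W
  decode θ Q A := Function.invFun (fun W n => blockAnswer (ans n (ofBits G (Q n))) W) A θ

variable {N M k B : ℕ} {c : Fin N → Fin M → G} {d : Fin N → ℕ}
  {ans : ∀ n, G → Library M k → Fin (d n) → Bool}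

theorem shiftScheme_isCorrect (h : ∀ θ x W W',
    (∀ n, ans n (x + c n θ) W = ans n (x + c n θ) W') → W θ = W' θ) :
    (shiftScheme B c ans).IsCorrect := by
  refine fun θ => Eventually.of_forall fun (x : G) W => ?_
  let answers : Library M (B * k) → Fin N → List Bool := fun W n =>
    (shiftScheme B c ans).answer n (toBits (x + c n θ)) W
  change Function.invFun answers (answers W) θ = W θ
  have hanswers : answers (Function.invFun answers (answers W)) = answers W :=
    Function.invFun_eq ⟨W, rfl⟩
  refine eq_of_libraryBlock_eq fun b => h θ x _ _ fun n => ?_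
  have hblock := blockAnswer_injective (congrFun hanswers n) b
  rwa [ofBits_toBits] at hblock

theorem shiftScheme_isPrivate : (shiftScheme B c ans).IsPrivate := by
  classical
  have hlaw (n : Fin N) (θ : Fin M) (q : List Bool) :
      (shiftScheme B c ans).law {x | (shiftScheme B c ans).query n θ x = q} =
        (Fintype.card {x : G // toBits x = q} : ℝ≥0∞) / Fintype.card G := by
    let _ : MeasurableSpace G := ⊤
    change (PMF.uniformOfFintype G).toMeasure {x : G | toBits (x + c n θ) = q} = _
    rw [PMF.toMeasure_uniformOfFintype_apply _ MeasurableSpace.measurableSet_top]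
    congr 2
    exact Fintype.card_congr ((Equiv.addRight (c n θ)).subtypeEquiv fun _ => Iff.rfl)
  intro n θ θ' q
  rw [hlaw, hlaw]

end Shift

/-! ### Three schemes for two servers and three messages of eight bits -/

/-- The first server returns the whole library. -/
def fullAnswer : ∀ n, Unit → Library 3 1 → Fin (![3, 0] n) → Bool
  | 0, _, W => fun m => W m 0
  | 1, _, _ => Fin.elim0

/-- The scheme that downloads the whole library from the first server. -/
noncomputable def fullScheme : PIRScheme 2 3 8 := shiftScheme 8 0 fullAnswer

theorem fullScheme_hasSizes : fullScheme.HasSizes ![24, 0] :=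
  fun n _ _ => by fin_cases n <;> rfl

theorem fullScheme_isCorrect : fullScheme.IsCorrect :=
  shiftScheme_isCorrect fun θ _ _ _ h => funext fun i =>
    Subsingleton.elim 0 i ▸ congrFun (h 0) θ

theorem fullScheme_isPrivate : fullScheme.IsPrivate := shiftScheme_isPrivate

/-- The first server returns bit `x m` of every message `m`, the second the sum of these bits. -/
def pairAnswer : ∀ n, (Fin 3 → Fin 2) → Library 3 2 → Fin (![3, 1] n) → Bool
  | 0, x, W => fun m => W m (x m)
  | 1, x, W => fun _ => W 0 (x 0) ^^ (W 1 (x 1) ^^ W 2 (x 2))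

/-- The scheme in which the bits queried from the two servers differ for the desired message and
agree for the others. -/
noncomputable def pairScheme : PIRScheme 2 3 8 :=
  shiftScheme 4 ![0, fun θ => Pi.single θ 1] pairAnswer

theorem pairScheme_hasSizes : pairScheme.HasSizes ![12, 4] :=
  fun n _ _ => by fin_cases n <;> rfl

theorem pairScheme_isCorrect : pairScheme.IsCorrect := by
  refine shiftScheme_isCorrect fun θ x W W' h => funext fun i => ?_
  have hsingle (m : Fin 3) : W m (x m) = W' m (x m) := by
    simpa [pairAnswer] using congrFun (h 0) m
  have hsum := congrFun (h 1) (0 : Fin 1)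
  obtain rfl | rfl : i = x θ ∨ i = x θ + 1 := by generalize x θ = a; revert a i; decide
  · exact hsingle θ
  · fin_cases θ <;> simpa [pairAnswer, hsingle] using hsum

theorem pairScheme_isPrivate : pairScheme.IsPrivate := shiftScheme_isPrivate

/-- The first server returns bit `x m` of every message `m` and the sum of the bits `x m + 2`, the
second a sum for every pair of messages. -/
def quadAnswer : ∀ n, (Fin 3 → Fin 4) → Library 3 4 → Fin (![4, 3] n) → Bool
  | 0, x, W => ![W 0 (x 0), W 1 (x 1), W 2 (x 2),
      W 0 (x 0 + 2) ^^ (W 1 (x 1 + 2) ^^ W 2 (x 2 + 2))]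
  | 1, x, W => ![W 0 (x 0) ^^ W 1 (x 1), W 0 (x 0 + 2) ^^ W 2 (x 2),
      W 1 (x 1 + 2) ^^ W 2 (x 2 + 2)]

/-- The shifts, for each desired message, of the second query relative to the first. In the sums of
the second server the undesired bits are those known from the first server, alone or as a sum, and
the desired bits are new. -/
def quadShift : Fin 3 → Fin 3 → Fin 4 := ![![1, 0, 0], ![0, 1, 2], ![2, 2, 1]]

/-- The scheme in which `quadAnswer` is queried at a random position and at its shift. -/
noncomputable def quadScheme : PIRScheme 2 3 8 := shiftScheme 2 ![0, quadShift] quadAnswer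

theorem quadScheme_hasSizes : quadScheme.HasSizes ![8, 6] :=
  fun n _ _ => by fin_cases n <;> rfl

theorem quadScheme_isCorrect : quadScheme.IsCorrect := by
  refine shiftScheme_isCorrect fun θ x W W' h => funext fun i => ?_
  have hoffset (a : Fin 4) : a + 2 + 2 = a ∧ a + 1 + 2 = a + 3 := by revert a; decide
  have hposition : i = x θ ∨ i = x θ + 1 ∨ i = x θ + 2 ∨ i = x θ + 3 := by
    generalize x θ = a; revert a i; decide
  obtain ⟨h₀, h₁, h₂, hsum⟩ : W 0 (x 0) = W' 0 (x 0) ∧ W 1 (x 1) = W' 1 (x 1) ∧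
      W 2 (x 2) = W' 2 (x 2) ∧ (W 0 (x 0 + 2) ^^ (W 1 (x 1 + 2) ^^ W 2 (x 2 + 2))) =
        (W' 0 (x 0 + 2) ^^ (W' 1 (x 1 + 2) ^^ W' 2 (x 2 + 2))) := by
    simpa [quadAnswer] using h 0
  have hcancel : ∀ a b c a' b' c' : Bool, (a ^^ (b ^^ c)) = (a' ^^ (b' ^^ c')) →
      ((b ^^ c) = (b' ^^ c') → a = a') ∧ ((a ^^ c) = (a' ^^ c') → b = b') ∧
        ((a ^^ b) = (a' ^^ b') → c = c') := by decide
  obtain ⟨hcancel₀, hcancel₁, hcancel₂⟩ := hcancel _ _ _ _ _ _ hsum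
  fin_cases θ
  · obtain ⟨hnew₁, hnew₃, hknown⟩ : W 0 (x 0 + 1) = W' 0 (x 0 + 1) ∧
        W 0 (x 0 + 3) = W' 0 (x 0 + 3) ∧
        (W 1 (x 1 + 2) ^^ W 2 (x 2 + 2)) = (W' 1 (x 1 + 2) ^^ W' 2 (x 2 + 2)) := by
      simpa [quadAnswer, quadShift, hoffset, h₀, h₁, h₂] using h 1
    rcases hposition with rfl | rfl | rfl | rfl
    exacts [h₀, hnew₁, hcancel₀ hknown, hnew₃]
  · obtain ⟨hnew₁, hknown, hnew₃⟩ : W 1 (x 1 + 1) = W' 1 (x 1 + 1) ∧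
        (W 0 (x 0 + 2) ^^ W 2 (x 2 + 2)) = (W' 0 (x 0 + 2) ^^ W' 2 (x 2 + 2)) ∧
        W 1 (x 1 + 3) = W' 1 (x 1 + 3) := by
      simpa [quadAnswer, quadShift, hoffset, h₀, h₁, h₂] using h 1
    rcases hposition with rfl | rfl | rfl | rfl
    exacts [h₁, hnew₁, hcancel₁ hknown, hnew₃]
  · obtain ⟨hknown, hnew₁, hnew₃⟩ :
        (W 0 (x 0 + 2) ^^ W 1 (x 1 + 2)) = (W' 0 (x 0 + 2) ^^ W' 1 (x 1 + 2)) ∧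
        W 2 (x 2 + 1) = W' 2 (x 2 + 1) ∧ W 2 (x 2 + 3) = W' 2 (x 2 + 3) := by
      simpa [quadAnswer, quadShift, hoffset, h₀, h₁, h₂] using h 1
    rcases hposition with rfl | rfl | rfl | rfl
    exacts [h₂, hnew₁, hcancel₂ hknown, hnew₃]

theorem quadScheme_isPrivate : quadScheme.IsPrivate := shiftScheme_isPrivate

/-! ### The linear program -/

section LinearProgram

variable {L R v : ℝ} {μ : Fin 2 → ℝ}

theorem min_affine_le {a b x : ℝ} (hx : x ∈ Set.Icc a b) (p q : ℝ) :
    min (p + q * a) (p + q * b) ≤ p + q * x := by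
  rcases le_total 0 q with hq | hq
  · exact min_le_of_left_le (by gcongr; exact hx.1)
  · exact min_le_of_right_le (by linarith [mul_le_mul_of_nonpos_left hx.2 hq])

theorem lpValues_anti {R' : ℝ} (hL : 0 ≤ L) (hR : 0 < R) (h : R ≤ R') :
    lpValues L μ R' ⊆ lpValues L μ R := by
  rintro v ⟨d, D, hd, hsum, hlower, hupper, hbounds, rfl⟩
  exact ⟨d, D, hd, hsum, hlower, hupper.trans (by gcongr), hbounds, rfl⟩

theorem nonneg_of_mem_lpValues (hμ : ∀ n, 0 ≤ μ n) (hv : v ∈ lpValues L μ R) : 0 ≤ v := by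
  obtain ⟨d, D, hd, -, -, -, -, rfl⟩ := hv
  exact mul_nonneg zero_le_two (Finset.sum_nonneg fun n _ => mul_nonneg (hμ n) (hd n))

theorem lpValues_nonempty (hL : 0 ≤ L) (hR : 0 < R) (hR' : R ≤ 4 / 7) :
    (lpValues L μ R).Nonempty := by
  have hrate : 7 / 4 * L ≤ L / R := by
    rw [le_div_iff₀ hR]
    nlinarith
  refine ⟨_, ![L, 3 / 4 * L], 7 / 4 * L, ?_, ?_, le_rfl, hrate, ?_, rfl⟩
  · rw [Fin.forall_fin_two]
    exact ⟨hL, by change 0 ≤ 3 / 4 * L; positivity⟩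
  · simp only [Fin.sum_univ_two, Matrix.cons_val_zero, Matrix.cons_val_one]
    ring
  · simp only [Fin.forall_fin_two, Matrix.cons_val_zero, Matrix.cons_val_one, max_le_iff]
    refine ⟨⟨?_, ?_⟩, ?_, ?_⟩ <;> linarith

theorem monotoneOn_sInf_lpValues (hL : 0 ≤ L) (hμ : ∀ n, 0 ≤ μ n) :
    MonotoneOn (fun R => sInf (lpValues L μ R)) (Set.Ioc 0 (4 / 7)) := fun _ hR _ hR' h =>
  csInf_le_csInf ⟨0, fun _ => nonneg_of_mem_lpValues hμ⟩ (lpValues_nonempty hL hR'.1 hR'.2)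
    (lpValues_anti hL hR.1 h)

/-- For a given total download `D` the program downloads as little as possible from the slower
server, namely `3 / 2 * L - D / 2` or `5 / 2 * L - D` bits. -/
theorem exists_total_le_of_mem_lpValues (hμ : μ 0 ≤ μ 1) (hv : v ∈ lpValues L μ R) :
    ∃ D ∈ Set.Icc (7 / 4 * L) (L / R),
      3 * L * (μ 1 - μ 0) + (3 * μ 0 - μ 1) * D ≤ v ∧
      5 * L * (μ 1 - μ 0) + 2 * (2 * μ 0 - μ 1) * D ≤ v := by
  obtain ⟨d, D, -, hsum, hlower, hupper, hbounds, rfl⟩ := hv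
  obtain ⟨hslow, hslow'⟩ := max_le_iff.1 (hbounds 1)
  have hvalue : 2 * ∑ n, μ n * d n = 2 * (μ 0 * D + (μ 1 - μ 0) * d 1) := by
    rw [← hsum, Fin.sum_univ_two, Fin.sum_univ_two]
    ring
  rw [hvalue]
  exact ⟨D, ⟨hlower, hupper⟩, by linarith [mul_le_mul_of_nonneg_left hslow (sub_nonneg.2 hμ)],
    by linarith [mul_le_mul_of_nonneg_left hslow' (sub_nonneg.2 hμ)]⟩

theorem min_two_le_of_mem_lpValues (hμ : μ 0 ≤ μ 1) (hv : v ∈ lpValues L μ R) :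
    min (2 * L * μ 0 + 3 / 2 * L * μ 1)
      (2 * L * (5 / 2 * (μ 1 - μ 0) + 1 / R * (2 * μ 0 - μ 1))) ≤ v := by
  obtain ⟨D, hD, -, hDv⟩ := exists_total_le_of_mem_lpValues hμ hv
  refine Eq.trans_le ?_ ((min_affine_le hD _ _).trans hDv)
  congr 1 <;> ring

theorem min_three_le_of_mem_lpValues (hμ : μ 0 ≤ μ 1) (hv : v ∈ lpValues L μ R) :
    min (2 * L * μ 0 + 3 / 2 * L * μ 1) (min (3 * L * μ 0 + L * μ 1)
      (L * (3 * (μ 1 - μ 0) + 1 / R * (3 * μ 0 - μ 1)))) ≤ v := by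
  obtain ⟨D, hD, hDv, hDv'⟩ := exists_total_le_of_mem_lpValues hμ hv
  rcases le_total D (2 * L) with hDL | hDL
  · refine (min_le_min_left _ (min_le_left _ _)).trans ?_
    refine Eq.trans_le ?_ ((min_affine_le ⟨hD.1, hDL⟩ _ _).trans hDv')
    congr 1 <;> ring
  · refine (min_le_right _ _).trans ?_
    refine Eq.trans_le ?_ ((min_affine_le ⟨hDL, hD.2⟩ _ _).trans hDv)
    congr 1 <;> ring

end LinearProgram

/-! ### Optimal peak age -/

section Optimal

variable {Ω : Type*} [MeasurableSpace Ω] {P : Measure Ω} {N M L : ℕ} {μ : Fin N → ℝ}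
  {Z : Fin N → ℕ → Ω → ℝ} {R : ℝ}

theorem monotone_sInf_peakValues (θ : Fin M) :
    Monotone fun R => sInf (peakValues P M L Z θ R) := by
  intro R R' h
  refine sInf_le_sInf ?_
  rintro v ⟨S, hS, rfl⟩
  exact ⟨S, hS.mono h, rfl⟩

variable [IsProbabilityMeasure P] [NeZero N]

theorem feasible_and_peakAoI_eq (hZ : IsDelayModel P Z μ) (hR : 0 < R) (hL : 0 < L)
    {S : PIRScheme N M L} (hc : S.IsCorrect) (hp : S.IsPrivate) (hb : S.HasBoundedDownloads)
    (hD : ∀ θ, ∑ n, S.meanDownload n θ ≤ L / R) {θ : Fin M} {v : ℝ}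
    (hv : 2 * ∑ n, μ n * S.meanDownload n θ = v) :
    S.Feasible R ∧ peakAoI P Z S θ = ENNReal.ofReal v :=
  ⟨⟨hc, hp, fun θ => (PIRScheme.ofReal_le_rate_iff (hb.integrable · θ) hR hL).2 (hD θ)⟩,
    hv ▸ PIRScheme.peakAoI_eq_ofReal hZ (hc.ae_download_pos hL θ) hb⟩

end Optimal

section TwoServers

variable {Ω : Type*} [MeasurableSpace Ω] {P : Measure Ω} [IsProbabilityMeasure P] {L : ℕ}
  {μ : Fin 2 → ℝ} {Z : Fin 2 → ℕ → Ω → ℝ} {R : ℝ} {θ : Fin 3}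

theorem PIRScheme.Feasible.mem_lpValues {S : PIRScheme 2 3 L} (hS : S.Feasible R) (hR : 0 < R)
    (hL : 0 < L) (μ : Fin 2 → ℝ) (θ : Fin 3) :
    2 * ∑ n, μ n * S.meanDownload n θ ∈ lpValues L μ R := by
  have hint := hS.integrable hR
  obtain ⟨htotal, hserver⟩ := PIRScheme.meanDownload_bounds hS.1 hS.2.1 hint θ
  exact ⟨fun n => S.meanDownload n θ, _, fun n => S.meanDownload_nonneg n θ, rfl, htotal,
    (PIRScheme.ofReal_le_rate_iff (hint · θ) hR hL).1 (hS.2.2 θ), hserver, rfl⟩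

theorem PIRScheme.Feasible.exists_lpValue_pos_le (hZ : IsDelayModel P Z μ) {S : PIRScheme 2 3 L}
    (hS : S.Feasible R) (hR : 0 < R) (hL : 0 < L) (θ : Fin 3) :
    ∃ w ∈ lpValues L μ R, 0 < w ∧ ENNReal.ofReal w ≤ peakAoI P Z S θ := by
  have hint (n : Fin 2) := hS.integrable hR n θ
  have hpos := hS.1.ae_download_pos hL θ
  exact ⟨_, hS.mem_lpValues hR hL μ θ,
    mul_pos two_pos (PIRScheme.sum_mul_meanDownload_pos hint hpos hZ.mean_pos),
    PIRScheme.ofReal_le_peakAoI hZ hint hpos⟩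

theorem isLeast_peakValues_and_lpValues (hZ : IsDelayModel P Z μ) (hR : 0 < R) (hL : 0 < L) {v : ℝ}
    (hv : v ∈ lowerBounds (lpValues L μ R))
    (hmem : ENNReal.ofReal v ∈ peakValues P 3 L Z θ R) :
    IsLeast (peakValues P 3 L Z θ R) (ENNReal.ofReal v) ∧ IsLeast (lpValues L μ R) v := by
  refine ⟨⟨hmem, ?_⟩, ?_, hv⟩
  · rintro _ ⟨S', hS', rfl⟩
    obtain ⟨w, hw, -, hle⟩ := hS'.exists_lpValue_pos_le hZ hR hL θ
    exact (ENNReal.ofReal_le_ofReal (hv hw)).trans hle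
  · obtain ⟨S, hS, hpeak⟩ := hmem
    obtain ⟨w, hw, hwpos, hle⟩ := hS.exists_lpValue_pos_le hZ hR hL θ
    rw [← hpeak, ENNReal.ofReal_le_ofReal_iff'] at hle
    rwa [(hv hw).antisymm (hle.resolve_right hwpos.not_ge)]

theorem quadScheme_feasible_and_peakAoI_eq (hZ : IsDelayModel P Z μ) (hR : 0 < R)
    (hR' : R ≤ 4 / 7) :
    quadScheme.Feasible R ∧ peakAoI P Z quadScheme θ = ENNReal.ofReal (16 * μ 0 + 12 * μ 1) := by
  refine feasible_and_peakAoI_eq hZ hR (by norm_num) quadScheme_isCorrect quadScheme_isPrivate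
    quadScheme_hasSizes.hasBoundedDownloads (fun θ => ?_) ?_ <;>
  simp only [quadScheme_hasSizes.meanDownload_eq, Fin.sum_univ_two, Matrix.cons_val_zero,
    Matrix.cons_val_one, Nat.cast_ofNat]
  · rw [le_div_iff₀ hR]
    linarith
  · ring

theorem pairScheme_feasible_and_peakAoI_eq (hZ : IsDelayModel P Z μ) (hR : 0 < R)
    (hR' : R ≤ 1 / 2) :
    pairScheme.Feasible R ∧ peakAoI P Z pairScheme θ = ENNReal.ofReal (24 * μ 0 + 8 * μ 1) := by
  refine feasible_and_peakAoI_eq hZ hR (by norm_num) pairScheme_isCorrect pairScheme_isPrivate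
    pairScheme_hasSizes.hasBoundedDownloads (fun θ => ?_) ?_ <;>
  simp only [pairScheme_hasSizes.meanDownload_eq, Fin.sum_univ_two, Matrix.cons_val_zero,
    Matrix.cons_val_one, Nat.cast_ofNat]
  · rw [le_div_iff₀ hR]
    linarith
  · ring

theorem timeShare_pairScheme_quadScheme_feasible_and_peakAoI_eq (hZ : IsDelayModel P Z μ)
    (hR : R ∈ Set.Icc (1 / 2 : ℝ) (4 / 7)) :
    ∃ p : unitInterval, (p : ℝ) = 4 / R - 7 ∧
      (PIRScheme.timeShare p pairScheme quadScheme).Feasible R ∧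
      peakAoI P Z (PIRScheme.timeShare p pairScheme quadScheme) θ =
        ENNReal.ofReal (16 * (5 / 2 * (μ 1 - μ 0) + 1 / R * (2 * μ 0 - μ 1))) := by
  have hR₀ : 0 < R := by linarith [hR.1]
  have hp : 4 / R - 7 ∈ unitInterval := by
    rw [Set.mem_Icc, le_sub_iff_add_le, sub_le_iff_le_add, le_div_iff₀ hR₀, div_le_iff₀ hR₀]
    constructor <;> linarith [hR.1, hR.2]
  have hpair := pairScheme_hasSizes.hasBoundedDownloads
  have hquad := quadScheme_hasSizes.hasBoundedDownloads
  refine ⟨⟨_, hp⟩, rfl, feasible_and_peakAoI_eq hZ hR₀ (by norm_num)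
    (pairScheme_isCorrect.timeShare _ quadScheme_isCorrect)
    (pairScheme_isPrivate.timeShare _ quadScheme_isPrivate) (hpair.timeShare _ hquad)
    (fun θ => ?_) ?_⟩ <;>
  simp only [PIRScheme.meanDownload_timeShare _ hpair hquad, pairScheme_hasSizes.meanDownload_eq,
    quadScheme_hasSizes.meanDownload_eq, Fin.sum_univ_two, Matrix.cons_val_zero,
    Matrix.cons_val_one, Nat.cast_ofNat]
  · exact le_of_eq (by ring)
  · ring

theorem timeShare_fullScheme_pairScheme_feasible_and_peakAoI_eq (hZ : IsDelayModel P Z μ)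
    (hR : R ∈ Set.Icc (1 / 3 : ℝ) (1 / 2)) :
    ∃ p : unitInterval, (p : ℝ) = 1 / R - 2 ∧
      (PIRScheme.timeShare p fullScheme pairScheme).Feasible R ∧
      peakAoI P Z (PIRScheme.timeShare p fullScheme pairScheme) θ =
        ENNReal.ofReal (8 * (3 * (μ 1 - μ 0) + 1 / R * (3 * μ 0 - μ 1))) := by
  have hR₀ : 0 < R := by linarith [hR.1]
  have hp : 1 / R - 2 ∈ unitInterval := by
    rw [Set.mem_Icc, le_sub_iff_add_le, sub_le_iff_le_add, le_div_iff₀ hR₀, div_le_iff₀ hR₀]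
    constructor <;> linarith [hR.1, hR.2]
  have hfull := fullScheme_hasSizes.hasBoundedDownloads
  have hpair := pairScheme_hasSizes.hasBoundedDownloads
  refine ⟨⟨_, hp⟩, rfl, feasible_and_peakAoI_eq hZ hR₀ (by norm_num)
    (fullScheme_isCorrect.timeShare _ pairScheme_isCorrect)
    (fullScheme_isPrivate.timeShare _ pairScheme_isPrivate) (hfull.timeShare _ hpair)
    (fun θ => ?_) ?_⟩ <;>
  simp only [PIRScheme.meanDownload_timeShare _ hfull hpair, fullScheme_hasSizes.meanDownload_eq,
    pairScheme_hasSizes.meanDownload_eq, Fin.sum_univ_two, Matrix.cons_val_zero,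
    Matrix.cons_val_one, Nat.cast_ofNat]
  · exact le_of_eq (by ring)
  · ring

theorem isLeast_min_two (hZ : IsDelayModel P Z μ) (hμ : μ 0 ≤ μ 1)
    (hR : R ∈ Set.Icc (1 / 2 : ℝ) (4 / 7)) :
    IsLeast (peakValues P 3 8 Z θ R) (ENNReal.ofReal
      (min (16 * μ 0 + 12 * μ 1) (16 * (5 / 2 * (μ 1 - μ 0) + 1 / R * (2 * μ 0 - μ 1))))) ∧
    IsLeast (lpValues 8 μ R)
      (min (16 * μ 0 + 12 * μ 1) (16 * (5 / 2 * (μ 1 - μ 0) + 1 / R * (2 * μ 0 - μ 1)))) := by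
  have hR₀ : 0 < R := by linarith [hR.1]
  obtain ⟨p, -, hshare⟩ :=
    timeShare_pairScheme_quadScheme_feasible_and_peakAoI_eq (θ := θ) hZ hR
  have hquad := quadScheme_feasible_and_peakAoI_eq (θ := θ) hZ hR₀ hR.2
  refine isLeast_peakValues_and_lpValues hZ hR₀ (by norm_num) (fun v hv => ?_)
    (min_rec' (ENNReal.ofReal · ∈ peakValues P 3 8 Z θ R) ⟨_, hquad.1, hquad.2.symm⟩
      ⟨_, hshare.1, hshare.2.symm⟩)
  convert min_two_le_of_mem_lpValues hμ hv using 3 <;> norm_num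

theorem isLeast_min_three (hZ : IsDelayModel P Z μ) (hμ : μ 0 ≤ μ 1)
    (hR : R ∈ Set.Icc (1 / 3 : ℝ) (1 / 2)) :
    IsLeast (peakValues P 3 8 Z θ R) (ENNReal.ofReal
      (min (16 * μ 0 + 12 * μ 1) (min (24 * μ 0 + 8 * μ 1)
        (8 * (3 * (μ 1 - μ 0) + 1 / R * (3 * μ 0 - μ 1)))))) ∧
    IsLeast (lpValues 8 μ R)
      (min (16 * μ 0 + 12 * μ 1) (min (24 * μ 0 + 8 * μ 1)
        (8 * (3 * (μ 1 - μ 0) + 1 / R * (3 * μ 0 - μ 1))))) := by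
  have hR₀ : 0 < R := by linarith [hR.1]
  obtain ⟨p, -, hshare⟩ :=
    timeShare_fullScheme_pairScheme_feasible_and_peakAoI_eq (θ := θ) hZ hR
  have hquad := quadScheme_feasible_and_peakAoI_eq (θ := θ) hZ hR₀ (by linarith [hR.2])
  have hpair := pairScheme_feasible_and_peakAoI_eq (θ := θ) hZ hR₀ hR.2
  refine isLeast_peakValues_and_lpValues hZ hR₀ (by norm_num) (fun v hv => ?_)
    (min_rec' (ENNReal.ofReal · ∈ peakValues P 3 8 Z θ R) ⟨_, hquad.1, hquad.2.symm⟩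
      (min_rec' (ENNReal.ofReal · ∈ peakValues P 3 8 Z θ R) ⟨_, hpair.1, hpair.2.symm⟩
        ⟨_, hshare.1, hshare.2.symm⟩))
  convert min_three_le_of_mem_lpValues hμ hv using 3 <;> norm_num

end TwoServers

theorem mainTheorem1 :
    ∃ S₁ S₃ S₄ : PIRScheme 2 3 8,
      (S₁.IsCorrect ∧ S₁.IsPrivate ∧ S₁.HasSizes ![24, 0]) ∧
      (S₃.IsCorrect ∧ S₃.IsPrivate ∧ S₃.HasSizes ![8, 6]) ∧
      (S₄.IsCorrect ∧ S₄.IsPrivate ∧ S₄.HasSizes ![12, 4]) ∧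
      ∀ (Ω : Type*) [MeasurableSpace Ω] (P : Measure Ω) [IsProbabilityMeasure P]
        (Z : Fin 2 → ℕ → Ω → ℝ) (μ : Fin 2 → ℝ), IsDelayModel P Z μ → μ 0 ≤ μ 1 →
      ∀ θ : Fin 3,
        (∀ R ∈ Set.Icc (1 / 2 : ℝ) (4 / 7),
          IsLeast (peakValues P 3 8 Z θ R) (ENNReal.ofReal
            (min (16 * μ 0 + 12 * μ 1)
              (16 * (5 / 2 * (μ 1 - μ 0) + 1 / R * (2 * μ 0 - μ 1))))) ∧
          IsLeast (lpValues 8 μ R)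
            (min (16 * μ 0 + 12 * μ 1)
              (16 * (5 / 2 * (μ 1 - μ 0) + 1 / R * (2 * μ 0 - μ 1)))) ∧
          (S₃.Feasible R ∧ peakAoI P Z S₃ θ = ENNReal.ofReal (16 * μ 0 + 12 * μ 1)) ∧
          ∃ p : unitInterval, (p : ℝ) = 4 / R - 7 ∧
            (PIRScheme.timeShare p S₄ S₃).Feasible R ∧
            peakAoI P Z (PIRScheme.timeShare p S₄ S₃) θ = ENNReal.ofReal
              (16 * (5 / 2 * (μ 1 - μ 0) + 1 / R * (2 * μ 0 - μ 1)))) ∧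
        (∀ R ∈ Set.Icc (1 / 3 : ℝ) (1 / 2),
          IsLeast (peakValues P 3 8 Z θ R) (ENNReal.ofReal
            (min (16 * μ 0 + 12 * μ 1) (min (24 * μ 0 + 8 * μ 1)
              (8 * (3 * (μ 1 - μ 0) + 1 / R * (3 * μ 0 - μ 1)))))) ∧
          IsLeast (lpValues 8 μ R)
            (min (16 * μ 0 + 12 * μ 1) (min (24 * μ 0 + 8 * μ 1)
              (8 * (3 * (μ 1 - μ 0) + 1 / R * (3 * μ 0 - μ 1))))) ∧
          (S₃.Feasible R ∧ peakAoI P Z S₃ θ = ENNReal.ofReal (16 * μ 0 + 12 * μ 1)) ∧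
          (S₄.Feasible R ∧ peakAoI P Z S₄ θ = ENNReal.ofReal (24 * μ 0 + 8 * μ 1)) ∧
          ∃ p : unitInterval, (p : ℝ) = 1 / R - 2 ∧
            (PIRScheme.timeShare p S₁ S₄).Feasible R ∧
            peakAoI P Z (PIRScheme.timeShare p S₁ S₄) θ = ENNReal.ofReal
              (8 * (3 * (μ 1 - μ 0) + 1 / R * (3 * μ 0 - μ 1)))) ∧
        MonotoneOn (fun R => sInf (peakValues P 3 8 Z θ R)) (Set.Icc (1 / 3 : ℝ) (4 / 7)) ∧
        MonotoneOn (fun R => sInf (lpValues 8 μ R)) (Set.Icc (1 / 3 : ℝ) (4 / 7)) := by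
  refine ⟨fullScheme, quadScheme, pairScheme,
    ⟨fullScheme_isCorrect, fullScheme_isPrivate, fullScheme_hasSizes⟩,
    ⟨quadScheme_isCorrect, quadScheme_isPrivate, quadScheme_hasSizes⟩,
    ⟨pairScheme_isCorrect, pairScheme_isPrivate, pairScheme_hasSizes⟩, ?_⟩
  intro Ω _ P _ Z μ hZ hμ θ
  refine ⟨fun R hR => ?high, fun R hR => ?low, (monotone_sInf_peakValues θ).monotoneOn _,
    (monotoneOn_sInf_lpValues (by norm_num) fun n => (hZ.mean_pos n).le).mono
      fun R hR => ⟨by linarith [hR.1], hR.2⟩⟩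
  case high =>
    have hR₀ : 0 < R := by linarith [hR.1]
    obtain ⟨hpeak, hlp⟩ := isLeast_min_two hZ hμ hR
    exact ⟨hpeak, hlp, quadScheme_feasible_and_peakAoI_eq hZ hR₀ hR.2,
      timeShare_pairScheme_quadScheme_feasible_and_peakAoI_eq hZ hR⟩
  case low =>
    have hR₀ : 0 < R := by linarith [hR.1]
    obtain ⟨hpeak, hlp⟩ := isLeast_min_three hZ hμ hR
    exact ⟨hpeak, hlp, quadScheme_feasible_and_peakAoI_eq hZ hR₀ (by linarith [hR.2]),
      pairScheme_feasible_and_peakAoI_eq hZ hR₀ hR.2,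
      timeShare_fullScheme_pairScheme_feasible_and_peakAoI_eq hZ hR⟩
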